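/- A holomorphic foliation $\mathcal F$ of degree $d\ge 0$ on $\mathbb P^2_{\mathbb C}$ is given, in homogeneous coordinates, by a $1$-form $\omega=A\,\mathrm dx+B\,\mathrm dy+C\,\mathrm dz$, unique up to a nonzero constant, where $A,B,C\in\mathbb C[x,y,z]$ are homogeneous of degree $d+1$, have no common factor, and satisfy $xA+yB+zC=0$. A quadratic birational map is a birational self-map $\psi=(\psi_0:\psi_1:\psi_2)$ of $\mathbb P^2_{\mathbb C}$ with $\psi_0,\psi_1,\psi_2$ homogeneous of degree $2$ without common factor. The pull-back $\psi^*\mathcal F$ is the foliation given by the $1$-form obtained from $\psi^*\omega$ by dividing out the greatest common divisor of its coefficients. Theorem. For every foliation $\mathcal F$ of degree $2$ on $\mathbb P^2_{\mathbb C}$ there exists a quadratic birational map $\psi$ of $\mathbb P^2_{\mathbb C}$ such that $\deg\psi^*\mathcal F\le 3$. -/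

import Mathlib

open MvPolynomial

/-- Polynomials in the homogeneous coordinates `(x, y, z) = (X 0, X 1, X 2)` of the
complex projective plane. -/
abbrev CoordPoly : Type := MvPolynomial (Fin 3) ℂ

/-- A triple of polynomials without common (nonconstant) factor. The zero triple is excluded,
since every polynomial divides it. -/
def NoCommonFactor (f : Fin 3 → CoordPoly) : Prop :=
  ∀ p : CoordPoly, (∀ i, p ∣ f i) → IsUnit p

/-- A rational self-map `(x : y : z) ⇢ (φ₀ : φ₁ : φ₂)` of the complex projective plane: the `φᵢ`
are homogeneous polynomials of the same degree and without common factor. Two triples give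
the same rational map iff they are proportional by a nonzero constant. -/
structure PlaneRationalMap where
  /-- the degree of the map -/
  degree : ℕ
  /-- the components of the map -/
  coord : Fin 3 → CoordPoly
  isHomogeneous : ∀ i, (coord i).IsHomogeneous degree
  noCommonFactor : NoCommonFactor coord

namespace PlaneRationalMap

/-- `φ ∘ ψ = id` as rational maps: the composed triple is `(Q x : Q y : Q z)` for a nonzero
polynomial `Q`. -/
def IsLeftInverse (φ ψ : PlaneRationalMap) : Prop :=
  ∃ Q : CoordPoly, Q ≠ 0 ∧ ∀ i, aeval ψ.coord (φ.coord i) = Q * X i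

/-- A birational map: a rational map that has a rational two-sided inverse. -/
def IsBirational (φ : PlaneRationalMap) : Prop :=
  ∃ ψ : PlaneRationalMap, φ.IsLeftInverse ψ ∧ ψ.IsLeftInverse φ

end PlaneRationalMap

/-- A holomorphic (singular) foliation of degree `degree` on the complex projective plane,
given by a homogeneous `1`-form `A dx + B dy + C dz` on `ℂ³`, with
`(A, B, C) = (coeff 0, coeff 1, coeff 2)`, such that `A, B, C` are homogeneous of degree
`degree + 1`, have no common factor (isolated singularities), and satisfy `x A + y B + z C = 0`.
The form is determined by the foliation up to a nonzero constant. -/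
structure PlaneFoliation where
  /-- the degree of the foliation -/
  degree : ℕ
  /-- the coefficients of `dx`, `dy`, `dz` -/
  coeff : Fin 3 → CoordPoly
  isHomogeneous : ∀ i, (coeff i).IsHomogeneous (degree + 1)
  euler : ∑ i, X i * coeff i = 0
  noCommonFactor : NoCommonFactor coeff

/-- The pull-back `ψ* ω` of the `1`-form `ω = ∑ᵢ ωᵢ dxᵢ` by the polynomial map `ψ`, that is
`∑ᵢ ωᵢ(ψ) dψᵢ`: its coefficient of `dxⱼ` is `∑ᵢ ωᵢ(ψ) ∂ψᵢ/∂xⱼ`. -/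
noncomputable def pullbackForm (ψ ω : Fin 3 → CoordPoly) (j : Fin 3) : CoordPoly :=
  ∑ i, aeval ψ (ω i) * pderiv j (ψ i)

namespace PlaneFoliation

/-- `G` is the pull-back foliation `ψ* F`: the form `ψ* ω_F` is not identically zero, and `ω_G` is
obtained from it by removing the common factor `P` of its coefficients. -/
def IsPullback (G : PlaneFoliation) (ψ : PlaneRationalMap) (F : PlaneFoliation) : Prop :=
  ∃ P : CoordPoly, P ≠ 0 ∧ ∀ j, pullbackForm ψ.coord F.coeff j = P * G.coeff j

end PlaneFoliation

/-! A quadratic map `ψ` pulls the cubic coefficients of `ω` back to coefficients of degree `2 * 3 +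
1 = 7`, so it suffices to split off a common cubic factor (`HasCubicDrop`). A line contracted by `ψ`
divides `ψ* ω` if its image, a base point of `ψ⁻¹`, is singular for the foliation; infinitely near
base points contribute likewise through blow-ups. Hence one looks for three singular points, proper
or infinitely near, forming the base locus of a quadratic map: three noncollinear points, two points
and a tangent direction, or one point with a second-order germ of conic.

With `(0 : 0 : 1)` singular, the tangent directions are the zeros of `a1 x² + (a2 + b1) xy + b2 y²`,
and `a1 = 0` makes `y = 0` one of them. On the parabola `y = k x²` (with `z = 1`) the form is then
`(a3 + k (a2 + 2 b1)) x² dx` up to higher order. This decides whether a further infinitely near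
point is available: one `k`, every `k`, or none.

Elimination gives a singular point (`exists_singular`). Local analysis there produces either the map
or a second singular point (`hasCubicDrop_or_hasTwoSingularPoints`). With two singular points, a
tangent direction off the line joining them suffices; in the exceptional case at both points, the
remaining singular points satisfy a quartic of exact degree four, which yields a third one off that
line (`hasCubicDrop_of_two_singular_points`). -/

/-! ### Factors of homogeneous polynomials -/

theorem coeff_aeval_X_mul_T {p : CoordPoly} (n : ℕ) :
    (aeval (fun i => Polynomial.C (X i : CoordPoly) * Polynomial.X) p).coeff n =
      homogeneousComponent n p := by
  rw [homogeneousComponent_apply, aeval_def, eval₂_eq', Polynomial.finsetSum_coeff,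
    Finset.sum_filter]
  refine Finset.sum_congr rfl fun d _ => ?_
  simp only [mul_pow, Finset.prod_mul_distrib, Finset.prod_pow_eq_pow_sum, ← Polynomial.C_pow]
  rw [show algebraMap ℂ (Polynomial CoordPoly) (coeff d p) = Polynomial.C (C (coeff d p)) from rfl,
    ← map_prod, ← mul_assoc, ← Polynomial.C_mul, Polynomial.coeff_C_mul_X_pow,
    monomial_eq, Finsupp.prod_fintype _ _ (by simp), Finsupp.degree_eq_sum]
  simp only [eq_comm]

/-- A factor of a nonzero homogeneous polynomial is homogeneous. -/
theorem isHomogeneous_of_mul_left {p q : CoordPoly} {n : ℕ} (h : (p * q).IsHomogeneous n)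
    (h0 : p * q ≠ 0) : ∃ k, p.IsHomogeneous k := by
  set Φ : CoordPoly →ₐ[ℂ] Polynomial CoordPoly :=
    aeval (fun i => Polynomial.C (X i : CoordPoly) * Polynomial.X) with hΦ
  -- Substituting `xᵢ T` for `xᵢ` makes the product a monomial in `T`. Degree and trailing degree in
  -- `T` are additive, so they agree for each factor.
  have key : Φ p * Φ q = Polynomial.C (p * q) * Polynomial.X ^ n := by
    rw [← map_mul]
    ext1 k
    rw [coeff_aeval_X_mul_T, homogeneousComponent_of_mem h, Polynomial.coeff_C_mul_X_pow]
  have hne : Φ p * Φ q ≠ 0 := by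
    rw [key]; simpa using h0
  have hp := left_ne_zero_of_mul hne
  have hq := right_ne_zero_of_mul hne
  have h1 := Polynomial.natDegree_mul hp hq
  have h2 := Polynomial.natTrailingDegree_mul hp hq
  rw [key, Polynomial.natDegree_C_mul_X_pow _ _ h0] at h1
  rw [key, Polynomial.C_mul_X_pow_eq_monomial, Polynomial.natTrailingDegree_monomial h0] at h2
  have h3 := Polynomial.natTrailingDegree_le_natDegree (Φ p)
  have h4 := Polynomial.natTrailingDegree_le_natDegree (Φ q)
  refine ⟨(Φ p).natDegree, ?_⟩
  have h5 : ∀ k, k ≠ (Φ p).natDegree → homogeneousComponent k p = 0 := by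
    intro k hk
    rw [← coeff_aeval_X_mul_T]
    rcases lt_or_gt_of_ne hk with hk | hk
    · have h6 : k < (Φ p).natTrailingDegree := by omega
      exact Polynomial.coeff_eq_zero_of_lt_natTrailingDegree h6
    · exact Polynomial.coeff_eq_zero_of_natDegree_lt hk
  intro d hd
  by_contra hne'
  apply hd
  have := congrArg (coeff d) (h5 d.degree (by
    rw [Finsupp.degree_eq_weight_one]; exact hne'))
  simpa [coeff_homogeneousComponent] using this

theorem isHomogeneous_of_mul_right {p q : CoordPoly} {n : ℕ} (h : (p * q).IsHomogeneous n)
    (h0 : p * q ≠ 0) : ∃ k, q.IsHomogeneous k := by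
  rw [mul_comm] at h h0
  exact isHomogeneous_of_mul_left h h0

/-! ### Pull-backs of forms -/

theorem pderiv_aeval_sum (ψ : Fin 3 → CoordPoly) (p : CoordPoly) (j : Fin 3) :
    pderiv j (aeval ψ p) = ∑ k, aeval ψ (pderiv k p) * pderiv j (ψ k) := by
  induction p using MvPolynomial.induction_on with
  | C a => simp
  | add p q hp hq => simp only [map_add, hp, hq, add_mul, Finset.sum_add_distrib]
  | mul_X p i hp =>
    simp only [map_mul, Derivation.leibniz, aeval_X, hp, smul_eq_mul, pderiv_X, map_add, add_mul,
      Finset.sum_add_distrib, Finset.mul_sum]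
    congr 1
    · rw [Finset.sum_eq_single i] <;> simp +contextual
    · exact Finset.sum_congr rfl fun k _ => by ring

/-- The chain rule for pull-backs. -/
theorem pullbackForm_comp (φ ψ ω : Fin 3 → CoordPoly) (j : Fin 3) :
    pullbackForm (fun i => aeval ψ (φ i)) ω j = pullbackForm ψ (pullbackForm φ ω) j := by
  simp only [pullbackForm, pderiv_aeval_sum, map_sum, map_mul, Finset.mul_sum, Finset.sum_mul]
  rw [Finset.sum_comm]
  refine Finset.sum_congr rfl fun k _ => Finset.sum_congr rfl fun i _ => ?_
  rw [← mul_assoc]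
  congr 2
  rw [← AlgHom.comp_apply, comp_aeval]

/-- The `1`-form `ω` has coefficients homogeneous of degree `3` without common factor, and is
killed by the radial vector field. -/
structure IsQuadraticForm (ω : Fin 3 → CoordPoly) : Prop where
  isHomogeneous : ∀ i, (ω i).IsHomogeneous 3
  euler : ∑ i, X i * ω i = 0
  noCommonFactor : NoCommonFactor ω

theorem NoCommonFactor.exists_ne_zero {f : Fin 3 → CoordPoly} (h : NoCommonFactor f) :
    ∃ i, f i ≠ 0 := by
  by_contra! hf
  exact not_isUnit_zero (h 0 fun i => by simp [hf])

theorem aeval_mul_X {p : CoordPoly} {n : ℕ} (hp : p.IsHomogeneous n) (Q : CoordPoly) :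
    aeval (fun i => Q * X i) p = Q ^ n * p := by
  conv_rhs => rw [p.as_sum]
  rw [aeval_def, eval₂_eq', Finset.mul_sum]
  refine Finset.sum_congr rfl fun d hd => ?_
  have hdeg : ∑ i, d i = n := by
    rw [← Finsupp.degree_eq_sum, Finsupp.degree_eq_weight_one]
    exact hp (mem_support_iff.mp hd)
  simp only [mul_pow, Finset.prod_mul_distrib, Finset.prod_pow_eq_pow_sum, hdeg]
  rw [monomial_eq, Finsupp.prod_fintype _ _ (by simp), MvPolynomial.algebraMap_eq]
  ring

/-- The pull-back of a quadratic form by `(Q x : Q y : Q z)` is `Q ^ 4` times the form. -/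
theorem pullbackForm_mul_X {ω : Fin 3 → CoordPoly} (h : IsQuadraticForm ω) (Q : CoordPoly)
    (j : Fin 3) : pullbackForm (fun i => Q * X i) ω j = Q ^ 4 * ω j := by
  -- In `d(Q xᵢ) = Q dxᵢ + xᵢ dQ` the `dQ` part is killed by the Euler relation.
  have e : ∑ i, Q ^ 3 * pderiv j Q * (X i * ω i) = 0 := by
    rw [← Finset.mul_sum, h.euler, mul_zero]
  calc pullbackForm (fun i => Q * X i) ω j
      = ∑ i, (Q ^ 3 * pderiv j Q * (X i * ω i) + Q ^ 4 * (ω i * pderiv j (X i))) := by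
        refine Finset.sum_congr rfl fun i _ => ?_
        rw [aeval_mul_X (h.isHomogeneous i), Derivation.leibniz, smul_eq_mul, smul_eq_mul]
        ring
    _ = Q ^ 4 * ω j := by
        rw [Finset.sum_add_distrib, e, zero_add, ← Finset.mul_sum]
        congr 1
        rw [Finset.sum_eq_single j] <;> simp +contextual [pderiv_X]

/-- Pulling back once more by the inverse of `ψ` recovers `Q ^ 4` times `ω`, which is nonzero. -/
theorem exists_pullbackForm_ne_zero {ω : Fin 3 → CoordPoly} (h : IsQuadraticForm ω)
    {ψ : PlaneRationalMap} (hψ : ψ.IsBirational) : ∃ j, pullbackForm ψ.coord ω j ≠ 0 := by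
  by_contra! h0
  obtain ⟨φ, ⟨Q, hQ, hQφ⟩, -⟩ := hψ
  obtain ⟨j, hj⟩ := h.noCommonFactor.exists_ne_zero
  have := pullbackForm_mul_X h Q j
  rw [← funext hQφ, pullbackForm_comp, funext h0] at this
  simp [pullbackForm] at this
  tauto

/-! ### From a cubic common factor to a foliation of degree at most three -/

/-- Some quadratic birational map pulls `ω` back to a form with a common factor of degree `3`. -/
def HasCubicDrop (ω : Fin 3 → CoordPoly) : Prop :=
  ∃ ψ : PlaneRationalMap, ψ.IsBirational ∧ ψ.degree = 2 ∧ ∃ (P : CoordPoly) (c : Fin 3 → CoordPoly),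
    P.IsHomogeneous 3 ∧ ∀ j, pullbackForm ψ.coord ω j = P * c j

theorem isHomogeneous_pullbackForm {ψ ω : Fin 3 → CoordPoly} {m n : ℕ}
    (hψ : ∀ i, (ψ i).IsHomogeneous m) (hω : ∀ i, (ω i).IsHomogeneous n) (j : Fin 3) :
    (pullbackForm ψ ω j).IsHomogeneous (m * n + (m - 1)) :=
  .sum _ _ _ fun i _ => ((hω i).aeval _ hψ).mul (hψ i).pderiv

theorem euler_pullbackForm {ψ ω : Fin 3 → CoordPoly} {m : ℕ}
    (hψ : ∀ i, (ψ i).IsHomogeneous m) (hω : ∑ i, X i * ω i = 0) :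
    ∑ j, X j * pullbackForm ψ ω j = 0 := by
  calc ∑ j, X j * pullbackForm ψ ω j
      = ∑ i, aeval ψ (ω i) * ∑ j, X j * pderiv j (ψ i) := by
        simp only [pullbackForm, Finset.mul_sum]
        rw [Finset.sum_comm]
        exact Finset.sum_congr rfl fun i _ => Finset.sum_congr rfl fun j _ => by ring
    _ = m • aeval ψ (∑ i, X i * ω i) := by
        rw [map_sum, Finset.smul_sum]
        refine Finset.sum_congr rfl fun i _ => ?_
        rw [(hψ i).sum_X_mul_pderiv, map_mul, aeval_X]
        simp only [nsmul_eq_mul]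
        ring
    _ = 0 := by rw [hω]; simp

theorem HasCubicDrop.exists_foliation {ω : Fin 3 → CoordPoly} (hω : IsQuadraticForm ω)
    (h : HasCubicDrop ω) : ∃ ψ : PlaneRationalMap, ψ.IsBirational ∧ ψ.degree = 2 ∧
      ∃ G : PlaneFoliation, (∃ P : CoordPoly, P ≠ 0 ∧
        ∀ j, pullbackForm ψ.coord ω j = P * G.coeff j) ∧ G.degree ≤ 3 := by
  obtain ⟨ψ, hψ, h2, P, c, hP, hc⟩ := h
  refine ⟨ψ, hψ, h2, ?_⟩
  have hψh := ψ.isHomogeneous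
  rw [h2] at hψh
  obtain ⟨j₀, hj₀⟩ := exists_pullbackForm_ne_zero hω hψ
  have : NormalizedGCDMonoid CoordPoly := Nonempty.some inferInstance
  obtain ⟨g, hg, hg1⟩ := Finset.extract_gcd (s := (Finset.univ : Finset (Fin 3))) c ⟨0, by simp⟩
  set D := Finset.univ.gcd c with hD
  have hfac : ∀ j, pullbackForm ψ.coord ω j = (P * D) * g j := fun j => by
    rw [hc, hg j (Finset.mem_univ j), mul_assoc]
  have hPD : P * D ≠ 0 := fun h0 => hj₀ (by rw [hfac, h0, zero_mul])
  have hhom := isHomogeneous_pullbackForm hψh hω.isHomogeneous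
  obtain ⟨k, hk⟩ : ∃ k, (P * D).IsHomogeneous k :=
    isHomogeneous_of_mul_left (hfac j₀ ▸ hhom j₀) (hfac j₀ ▸ hj₀)
  obtain ⟨e, he⟩ : ∃ e, D.IsHomogeneous e := isHomogeneous_of_mul_right hk hPD
  have hk' : k = 3 + e := hk.inj_right (hP.mul he) hPD
  have hgne : ∀ j, g j ≠ 0 → ∃ n, k + n = 7 ∧ (g j).IsHomogeneous n := fun j hj => by
    have hne : P * D * g j ≠ 0 := mul_ne_zero hPD hj
    have h7 := hfac j ▸ hhom j
    obtain ⟨n, hn⟩ := isHomogeneous_of_mul_right h7 hne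
    exact ⟨n, (hk.mul hn).inj_right h7 hne, hn⟩
  have heul : ∑ j, X j * g j = 0 := by
    have := euler_pullbackForm hψh hω.euler
    simp only [hfac] at this
    refine (mul_eq_zero.mp (?_ : P * D * ∑ j, X j * g j = 0)).resolve_left hPD
    rw [Finset.mul_sum, ← this]
    exact Finset.sum_congr rfl fun j _ => by ring
  have hg₀ : g j₀ ≠ 0 := fun h0 => hj₀ (by rw [hfac, h0, mul_zero])
  obtain ⟨n₀, hn₀, hn₀'⟩ := hgne j₀ hg₀
  have hgh : ∀ j, (g j).IsHomogeneous n₀ := fun j => by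
    by_cases hj : g j = 0
    · rw [hj]; exact isHomogeneous_zero _ _ _
    · obtain ⟨n, hn, hn'⟩ := hgne j hj
      rwa [show n₀ = n by omega]
  -- Constant coefficients cannot satisfy the Euler relation: at a basis vector it isolates one of
  -- them.
  have hn₀pos : n₀ ≠ 0 := by
    rintro rfl
    have hC : ∀ j, g j = C (coeff 0 (g j)) := fun j => by
      have := (hgh j)
      exact totalDegree_eq_zero_iff_eq_C.mp ((totalDegree_zero_iff_isHomogeneous _).mpr this)
    have := congrArg (eval (Pi.single j₀ 1)) heul
    rw [map_sum, Finset.sum_eq_single j₀ (by simp +contextual) (by simp)] at this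
    rw [hC, map_mul, eval_X, eval_C] at this
    apply hg₀
    rw [hC]
    simpa using this
  obtain ⟨d, rfl⟩ := Nat.exists_eq_succ_of_ne_zero hn₀pos
  refine ⟨⟨d, g, hgh, heul, fun p hp => ?_⟩, ⟨P * D, hPD, hfac⟩, ?_⟩
  · exact isUnit_of_dvd_one (hg1 ▸ Finset.dvd_gcd fun j _ => hp j)
  -- `d + 1 = 7 - (3 + e) ≤ 4`.
  · change d ≤ 3
    omega

/-! ### Linear changes of coordinates -/

/-- The linear map with matrix `M`, as a triple of linear forms. -/
noncomputable def linearTriple (M : Matrix (Fin 3) (Fin 3) ℂ) (i : Fin 3) : CoordPoly :=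
  ∑ j, C (M i j) * X j

theorem isHomogeneous_linearTriple (M : Matrix (Fin 3) (Fin 3) ℂ) (i : Fin 3) :
    (linearTriple M i).IsHomogeneous 1 :=
  .sum _ _ _ fun _ _ => isHomogeneous_C_mul_X _ _

theorem pderiv_linearTriple (M : Matrix (Fin 3) (Fin 3) ℂ) (i j : Fin 3) :
    pderiv j (linearTriple M i) = C (M i j) := by
  rw [linearTriple, map_sum, Finset.sum_eq_single j] <;>
    simp +contextual [pderiv_X]

theorem aeval_linearTriple (ψ : Fin 3 → CoordPoly) (M : Matrix (Fin 3) (Fin 3) ℂ) (i : Fin 3) :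
    aeval ψ (linearTriple M i) = ∑ j, C (M i j) * ψ j := by
  simp [linearTriple, MvPolynomial.algebraMap_eq]

theorem aeval_linearTriple_linearTriple (M N : Matrix (Fin 3) (Fin 3) ℂ) (i : Fin 3) :
    aeval (linearTriple N) (linearTriple M i) = linearTriple (M * N) i := by
  rw [aeval_linearTriple]
  simp only [linearTriple, Matrix.mul_apply, map_sum, map_mul, Finset.mul_sum, Finset.sum_mul]
  rw [Finset.sum_comm]
  exact Finset.sum_congr rfl fun k _ => Finset.sum_congr rfl fun j _ => by ring

theorem linearTriple_one : linearTriple 1 = X := by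
  funext i
  rw [linearTriple, Finset.sum_eq_single i] <;> simp +contextual [eq_comm]

theorem aeval_aeval (ψ φ : Fin 3 → CoordPoly) (p : CoordPoly) :
    aeval ψ (aeval φ p) = aeval (fun k => aeval ψ (φ k)) p := by
  rw [← AlgHom.comp_apply, comp_aeval]

theorem aeval_linearTriple_comp_cancel {M N : Matrix (Fin 3) (Fin 3) ℂ} (h : N * M = 1)
    (ψ : Fin 3 → CoordPoly) (i : Fin 3) :
    aeval (fun j => aeval ψ (linearTriple M j)) (linearTriple N i) = ψ i := by
  rw [← aeval_aeval, aeval_linearTriple_linearTriple, h, linearTriple_one, aeval_X]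

theorem aeval_linearTriple_cancel {M N : Matrix (Fin 3) (Fin 3) ℂ} (h : M * N = 1)
    (p : CoordPoly) : aeval (linearTriple N) (aeval (linearTriple M) p) = p := by
  rw [aeval_aeval]
  simp only [aeval_linearTriple_linearTriple, h, linearTriple_one]
  exact aeval_X_left_apply p

theorem eval_pullbackForm_linearTriple (M : Matrix (Fin 3) (Fin 3) ℂ) (ω : Fin 3 → CoordPoly)
    (j : Fin 3) (v : Fin 3 → ℂ) :
    eval v (pullbackForm (linearTriple M) ω j) = ∑ i, eval (M.mulVec v) (ω i) * M i j := by
  simp only [pullbackForm, map_sum, map_mul, pderiv_linearTriple, eval_C]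
  refine Finset.sum_congr rfl fun i _ => ?_
  congr 1
  rw [← aeval_eq_eval, ← aeval_eq_eval, ← AlgHom.comp_apply, comp_aeval]
  congr 2
  funext k
  simp [linearTriple, Matrix.mulVec, dotProduct]

theorem pullbackForm_linearTriple_cancel {M N : Matrix (Fin 3) (Fin 3) ℂ} (h : M * N = 1)
    (ω : Fin 3 → CoordPoly) :
    pullbackForm (linearTriple N) (pullbackForm (linearTriple M) ω) = ω := by
  funext j
  rw [← pullbackForm_comp]
  simp only [aeval_linearTriple_linearTriple, h, linearTriple_one]
  rw [pullbackForm, Finset.sum_eq_single j] <;>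
    simp +contextual [pderiv_X]

theorem dvd_pullbackForm_linearTriple {p : CoordPoly} {ω : Fin 3 → CoordPoly}
    (h : ∀ i, p ∣ ω i) (M : Matrix (Fin 3) (Fin 3) ℂ) (j : Fin 3) :
    aeval (linearTriple M) p ∣ pullbackForm (linearTriple M) ω j :=
  Finset.dvd_sum fun i _ => Dvd.dvd.mul_right (map_dvd _ (h i)) _

theorem NoCommonFactor.pullback_linearTriple {ω : Fin 3 → CoordPoly} (hω : NoCommonFactor ω)
    {M N : Matrix (Fin 3) (Fin 3) ℂ} (h : M * N = 1) :
    NoCommonFactor (pullbackForm (linearTriple M) ω) := by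
  intro p hp
  have := dvd_pullbackForm_linearTriple hp N
  rw [pullbackForm_linearTriple_cancel h] at this
  have := (hω _ this).map (aeval (linearTriple M))
  rwa [aeval_linearTriple_cancel (mul_eq_one_comm.mp h)] at this

theorem IsQuadraticForm.pullback_linearTriple {ω : Fin 3 → CoordPoly} (hω : IsQuadraticForm ω)
    {M N : Matrix (Fin 3) (Fin 3) ℂ} (h : M * N = 1) :
    IsQuadraticForm (pullbackForm (linearTriple M) ω) where
  isHomogeneous := isHomogeneous_pullbackForm (isHomogeneous_linearTriple M) hω.isHomogeneous
  euler := euler_pullbackForm (isHomogeneous_linearTriple M) hω.euler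
  noCommonFactor := hω.noCommonFactor.pullback_linearTriple h

namespace PlaneRationalMap

/-- The rational map followed by a linear automorphism. -/
noncomputable def linearComp (ψ : PlaneRationalMap) {M N : Matrix (Fin 3) (Fin 3) ℂ}
    (h : M * N = 1) : PlaneRationalMap where
  degree := ψ.degree
  coord i := aeval ψ.coord (linearTriple M i)
  isHomogeneous i := by
    simpa using (isHomogeneous_linearTriple M i).aeval ψ.coord ψ.isHomogeneous
  noCommonFactor p hp := by
    refine ψ.noCommonFactor p fun i => ?_
    have : ψ.coord i = ∑ j, C (N i j) * aeval ψ.coord (linearTriple M j) := by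
      rw [← aeval_linearTriple, aeval_linearTriple_comp_cancel (mul_eq_one_comm.mp h)]
    rw [this]
    exact Finset.dvd_sum fun j _ => Dvd.dvd.mul_left (hp j) _

/-- The rational map preceded by a linear automorphism. -/
noncomputable def compLinear (φ : PlaneRationalMap) {M N : Matrix (Fin 3) (Fin 3) ℂ}
    (h : M * N = 1) : PlaneRationalMap where
  degree := φ.degree
  coord i := aeval (linearTriple N) (φ.coord i)
  isHomogeneous i := by
    simpa using (φ.isHomogeneous i).aeval _ (isHomogeneous_linearTriple N)
  noCommonFactor p hp := by
    have : IsUnit (aeval (linearTriple M) p) := φ.noCommonFactor _ fun i => by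
      have := map_dvd (aeval (linearTriple M)) (hp i)
      rwa [aeval_linearTriple_cancel (mul_eq_one_comm.mp h)] at this
    have := this.map (aeval (linearTriple N))
    rwa [aeval_linearTriple_cancel h] at this

theorem IsBirational.linearComp {ψ : PlaneRationalMap} (hψ : ψ.IsBirational)
    {M N : Matrix (Fin 3) (Fin 3) ℂ} (h : M * N = 1) : (ψ.linearComp h).IsBirational := by
  obtain ⟨φ, ⟨Q, hQ, hψφ⟩, ⟨R, hR, hφψ⟩⟩ := hψ
  refine ⟨φ.compLinear h, ⟨aeval (linearTriple N) Q, fun h0 => hQ ?_, fun i => ?_⟩,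
    ⟨R, hR, fun i => ?_⟩⟩
  · rw [← aeval_linearTriple_cancel (mul_eq_one_comm.mp h) Q, h0, map_zero]
  · change aeval (fun k => aeval (linearTriple N) (φ.coord k))
      (aeval ψ.coord (linearTriple M i)) = _
    rw [aeval_linearTriple, map_sum]
    have : ∀ j, aeval (fun k => aeval (linearTriple N) (φ.coord k)) (ψ.coord j) =
        aeval (linearTriple N) Q * linearTriple N j := fun j => by
      have := congrArg (aeval (linearTriple N)) (hψφ j)
      rwa [← AlgHom.comp_apply, comp_aeval, map_mul, aeval_X] at this
    simp only [map_mul, this, aeval_C, MvPolynomial.algebraMap_eq]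
    have := congrFun (linearTriple_one.symm.trans (congrArg linearTriple h.symm)) i
    rw [this, ← aeval_linearTriple_linearTriple, aeval_linearTriple, Finset.mul_sum]
    exact Finset.sum_congr rfl fun j _ => by ring
  · change aeval (fun k => aeval ψ.coord (linearTriple M k))
      (aeval (linearTriple N) (φ.coord i)) = _
    rw [← hφψ, aeval_aeval]
    simp only [aeval_linearTriple_comp_cancel (mul_eq_one_comm.mp h)]

end PlaneRationalMap

theorem HasCubicDrop.of_pullback_linearTriple {ω : Fin 3 → CoordPoly}
    {M N : Matrix (Fin 3) (Fin 3) ℂ} (h : M * N = 1)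
    (hd : HasCubicDrop (pullbackForm (linearTriple M) ω)) : HasCubicDrop ω := by
  obtain ⟨ψ, hψ, h2, P, c, hP, hc⟩ := hd
  refine ⟨ψ.linearComp h, hψ.linearComp h, h2, P, c, hP, fun j => ?_⟩
  rw [← hc, ← pullbackForm_comp]
  rfl

/-! ### Coordinates on the space of quadratic forms -/

/-- The coefficients of a quadratic form `A dx + B dy + C dz`: the `aᵢ` and `bᵢ` are those of
`z³, xz², yz², x²z, xyz, y²z` in `A` and `B`, the `qᵢ` those of `x³, x²y, xy²` in `B`. -/
structure QuadraticCoeffs where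
  (a0 a1 a2 a3 a4 a5 b0 b1 b2 b3 b4 b5 q0 q1 q2 : ℂ)

namespace QuadraticCoeffs

/-- The quadratic form with the given coefficients. -/
noncomputable def form (c : QuadraticCoeffs) : Fin 3 → CoordPoly :=
  ![X 2 ^ 3 * C c.a0 + X 2 ^ 2 * (C c.a1 * X 0 + C c.a2 * X 1)
      + X 2 * (C c.a3 * X 0 ^ 2 + C c.a4 * (X 0 * X 1) + C c.a5 * X 1 ^ 2)
      - X 1 * (C c.q0 * X 0 ^ 2 + C c.q1 * (X 0 * X 1) + C c.q2 * X 1 ^ 2),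
    X 2 ^ 3 * C c.b0 + X 2 ^ 2 * (C c.b1 * X 0 + C c.b2 * X 1)
      + X 2 * (C c.b3 * X 0 ^ 2 + C c.b4 * (X 0 * X 1) + C c.b5 * X 1 ^ 2)
      + X 0 * (C c.q0 * X 0 ^ 2 + C c.q1 * (X 0 * X 1) + C c.q2 * X 1 ^ 2),
    -(X 2 ^ 2 * (C c.a0 * X 0 + C c.b0 * X 1)
      + X 2 * (C c.a1 * X 0 ^ 2 + (C c.a2 + C c.b1) * (X 0 * X 1) + C c.b2 * X 1 ^ 2)
      + (C c.a3 * X 0 ^ 3 + (C c.a4 + C c.b3) * (X 0 ^ 2 * X 1)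
        + (C c.a5 + C c.b4) * (X 0 * X 1 ^ 2) + C c.b5 * X 1 ^ 3))]

theorem eval_form_zero (c : QuadraticCoeffs) (x y z : ℂ) : eval ![x, y, z] (c.form 0) =
    z ^ 3 * c.a0 + z ^ 2 * (c.a1 * x + c.a2 * y)
      + z * (c.a3 * x ^ 2 + c.a4 * (x * y) + c.a5 * y ^ 2)
      - y * (c.q0 * x ^ 2 + c.q1 * (x * y) + c.q2 * y ^ 2) := by
  simp [form]

theorem eval_form_one (c : QuadraticCoeffs) (x y z : ℂ) : eval ![x, y, z] (c.form 1) =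
    z ^ 3 * c.b0 + z ^ 2 * (c.b1 * x + c.b2 * y)
      + z * (c.b3 * x ^ 2 + c.b4 * (x * y) + c.b5 * y ^ 2)
      + x * (c.q0 * x ^ 2 + c.q1 * (x * y) + c.q2 * y ^ 2) := by
  simp [form]

theorem eval_form_two (c : QuadraticCoeffs) (x y z : ℂ) : eval ![x, y, z] (c.form 2) =
    -(z ^ 2 * (c.a0 * x + c.b0 * y)
      + z * (c.a1 * x ^ 2 + (c.a2 + c.b1) * (x * y) + c.b2 * y ^ 2)
      + (c.a3 * x ^ 3 + (c.a4 + c.b3) * (x ^ 2 * y) + (c.a5 + c.b4) * (x * y ^ 2)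
        + c.b5 * y ^ 3)) := by
  simp [form]

end QuadraticCoeffs

/-- The exponent of the monomial `x ^ i * y ^ j * z ^ k`. -/
noncomputable def expo (i j k : ℕ) : Fin 3 →₀ ℕ := Finsupp.equivFunOnFinite.symm ![i, j, k]

theorem coeff_expo_X_zero_mul (i j k : ℕ) (p : CoordPoly) :
    coeff (expo i j k) (X 0 * p) = if i = 0 then 0 else coeff (expo (i - 1) j k) p := by
  rw [coeff_X_mul', ← ite_not (i = 0)]
  refine if_congr (by simp [expo]) ?_ rfl
  congr 1
  ext s
  fin_cases s <;> simp [expo]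

theorem coeff_expo_X_one_mul (i j k : ℕ) (p : CoordPoly) :
    coeff (expo i j k) (X 1 * p) = if j = 0 then 0 else coeff (expo i (j - 1) k) p := by
  rw [coeff_X_mul', ← ite_not (j = 0)]
  refine if_congr (by simp [expo]) ?_ rfl
  congr 1
  ext s
  fin_cases s <;> simp [expo]

theorem coeff_expo_X_two_mul (i j k : ℕ) (p : CoordPoly) :
    coeff (expo i j k) (X 2 * p) = if k = 0 then 0 else coeff (expo i j (k - 1)) p := by
  rw [coeff_X_mul', ← ite_not (k = 0)]
  refine if_congr (by simp [expo]) ?_ rfl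
  congr 1
  ext s
  fin_cases s <;> simp [expo]

theorem eq_sum_antidiagonalTuple {p : CoordPoly} {n : ℕ} (hp : p.IsHomogeneous n) :
    p = ∑ t ∈ Finset.Nat.antidiagonalTuple 3 n,
      C (coeff (expo (t 0) (t 1) (t 2)) p) * (X 0 ^ t 0 * X 1 ^ t 1 * X 2 ^ t 2) := by
  have key : ∀ t : Fin 3 → ℕ, expo (t 0) (t 1) (t 2) = Finsupp.equivFunOnFinite.symm t :=
    fun t => by ext s; fin_cases s <;> rfl
  conv_lhs => rw [p.as_sum]
  refine Finset.sum_of_injOn (fun d => ⇑d) DFunLike.coe_injective.injOn (fun d hd => ?_)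
    (fun t _ ht => ?_) (fun d _ => ?_)
  · rw [Finset.mem_coe, Finset.Nat.mem_antidiagonalTuple, ← Finsupp.degree_eq_sum,
      Finsupp.degree_eq_weight_one]
    exact hp (mem_support_iff.mp hd)
  · rw [key, notMem_support_iff.mp fun h => ht ⟨_, h, Finsupp.coe_equivFunOnFinite_symm t⟩]
    simp
  · rw [key, Finsupp.equivFunOnFinite_symm_coe, monomial_eq, Finsupp.prod_fintype _ _ (by simp),
      Fin.prod_univ_three]

/-- On `z = 0` the Euler relation forces `(A, B) = (-y q, x q)` with `q` a binary quadratic form;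
the terms of `A` and `B` divisible by `z` are free, and `C = -(x A + y B) / z`. -/
theorem IsQuadraticForm.exists_form {ω : Fin 3 → CoordPoly} (hω : IsQuadraticForm ω) :
    ∃ c : QuadraticCoeffs, ω = c.form := by
  have ha : ∀ i j k, (if i = 0 then 0 else coeff (expo (i - 1) j k) (ω 0))
      + (if j = 0 then 0 else coeff (expo i (j - 1) k) (ω 1))
      + (if k = 0 then 0 else coeff (expo i j (k - 1)) (ω 2)) = 0 := fun i j k => by
    have := congrArg (coeff (expo i j k)) hω.euler
    rwa [Fin.sum_univ_three, coeff_add, coeff_add, coeff_expo_X_zero_mul, coeff_expo_X_one_mul,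
      coeff_expo_X_two_mul, coeff_zero] at this
  have hl : Finset.Nat.antidiagonalTuple 3 3 = {![0, 0, 3], ![0, 1, 2], ![0, 2, 1], ![0, 3, 0],
    ![1, 0, 2], ![1, 1, 1], ![1, 2, 0], ![2, 0, 1], ![2, 1, 0], ![3, 0, 0]} := by decide
  have hs : ∀ i, ω i = _ := fun i => eq_sum_antidiagonalTuple (hω.isHomogeneous i)
  simp only [hl] at hs
  refine ⟨⟨coeff (expo 0 0 3) (ω 0), coeff (expo 1 0 2) (ω 0), coeff (expo 0 1 2) (ω 0),
    coeff (expo 2 0 1) (ω 0), coeff (expo 1 1 1) (ω 0), coeff (expo 0 2 1) (ω 0),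
    coeff (expo 0 0 3) (ω 1), coeff (expo 1 0 2) (ω 1), coeff (expo 0 1 2) (ω 1),
    coeff (expo 2 0 1) (ω 1), coeff (expo 1 1 1) (ω 1), coeff (expo 0 2 1) (ω 1),
    coeff (expo 3 0 0) (ω 1), coeff (expo 2 1 0) (ω 1), coeff (expo 1 2 0) (ω 1)⟩, ?_⟩
  have h400 := ha 4 0 0
  have h310 := ha 3 1 0
  have h301 := ha 3 0 1
  have h220 := ha 2 2 0
  have h211 := ha 2 1 1
  have h202 := ha 2 0 2
  have h130 := ha 1 3 0
  have h121 := ha 1 2 1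
  have h112 := ha 1 1 2
  have h103 := ha 1 0 3
  have h040 := ha 0 4 0
  have h031 := ha 0 3 1
  have h022 := ha 0 2 2
  have h013 := ha 0 1 3
  have h004 := ha 0 0 4
  simp only [Nat.reduceSub, reduceIte, OfNat.ofNat_ne_zero, one_ne_zero, add_zero, zero_add]
    at h400 h310 h301 h220 h211 h202 h130 h121 h112 h103 h040 h031 h022 h013 h004
  have n210 := eq_neg_of_add_eq_zero_left h310
  have n120 := eq_neg_of_add_eq_zero_left h220
  have n030 := eq_neg_of_add_eq_zero_left h130
  have n300 := eq_neg_of_add_eq_zero_right h301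
  have n210' := eq_neg_of_add_eq_zero_right h211
  have n201 := eq_neg_of_add_eq_zero_right h202
  have n120' := eq_neg_of_add_eq_zero_right h121
  have n111 := eq_neg_of_add_eq_zero_right h112
  have n102 := eq_neg_of_add_eq_zero_right h103
  have n030' := eq_neg_of_add_eq_zero_right h031
  have n021 := eq_neg_of_add_eq_zero_right h022
  have n012 := eq_neg_of_add_eq_zero_right h013
  funext i
  rw [hs i]
  rw [Finset.sum_insert (by decide), Finset.sum_insert (by decide), Finset.sum_insert (by decide),
    Finset.sum_insert (by decide), Finset.sum_insert (by decide), Finset.sum_insert (by decide),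
    Finset.sum_insert (by decide), Finset.sum_insert (by decide), Finset.sum_insert (by decide),
    Finset.sum_singleton]
  fin_cases i
  all_goals
    simp only [Fin.zero_eta, Fin.mk_one, Fin.reduceFinMk, QuadraticCoeffs.form,
      Matrix.cons_val_zero, Matrix.cons_val_one, Matrix.cons_val, h400, h040, h004, n210, n120,
      n030, n300, n210', n201, n120', n111, n102, n030', n021, n012, map_neg, map_add, map_zero]
    ring

/-! ### The quadratic birational maps -/

theorem not_X_dvd_of_eval {i : Fin 3} {f : CoordPoly} (v : Fin 3 → ℂ) (hv : v i = 0)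
    (hf : eval v f ≠ 0) : ¬ X i ∣ f := by
  rintro ⟨g, rfl⟩
  simp [hv] at hf

theorem Prime.X_dvd_of_dvd {p f : CoordPoly} {i : Fin 3} (hp : Prime p) (hi : p ∣ X i)
    (hf : p ∣ f) : X i ∣ f :=
  ((hp.associated_of_dvd X_prime hi).symm.dvd).trans hf

theorem noCommonFactor_of_prime {f : Fin 3 → CoordPoly} (i : Fin 3) (hi : f i ≠ 0)
    (h : ∀ p, Prime p → p ∣ f 0 → p ∣ f 1 → p ∣ f 2 → False) : NoCommonFactor f := by
  intro p hp
  by_contra hu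
  obtain ⟨q, hq, hqp⟩ := WfDvdMonoid.exists_irreducible_factor hu
    (fun h0 => hi (zero_dvd_iff.mp (h0 ▸ hp i)))
  exact h q hq.prime (hqp.trans (hp 0)) (hqp.trans (hp 1)) (hqp.trans (hp 2))

namespace PlaneRationalMap

/-- The standard quadratic involution `(yz : xz : xy)`. -/
noncomputable def standardInvolution : PlaneRationalMap where
  degree := 2
  coord := ![X 1 * X 2, X 0 * X 2, X 0 * X 1]
  isHomogeneous i := by
    fin_cases i <;> exact (isHomogeneous_X _ _).mul (isHomogeneous_X _ _)
  noCommonFactor := by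
    refine noCommonFactor_of_prime 0 (mul_ne_zero (X_ne_zero _) (X_ne_zero _))
      fun p hp h0 h1 h2 => ?_
    rcases hp.dvd_or_dvd h0 with h | h
    · exact not_X_dvd_of_eval ![1, 0, 1] rfl (by simp) (hp.X_dvd_of_dvd h h1)
    · exact not_X_dvd_of_eval ![1, 1, 0] rfl (by simp) (hp.X_dvd_of_dvd h h2)

/-- The quadratic map `(xy : y² : xz)`. -/
noncomputable def tangentialMap : PlaneRationalMap where
  degree := 2
  coord := ![X 0 * X 1, X 1 * X 1, X 0 * X 2]
  isHomogeneous i := by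
    fin_cases i <;> exact (isHomogeneous_X _ _).mul (isHomogeneous_X _ _)
  noCommonFactor := by
    refine noCommonFactor_of_prime 0 (mul_ne_zero (X_ne_zero _) (X_ne_zero _))
      fun p hp _ h1 h2 => ?_
    have h := (hp.dvd_or_dvd h1).elim id id
    exact not_X_dvd_of_eval ![1, 0, 1] rfl (by simp) (hp.X_dvd_of_dvd h h2)

/-- The quadratic map `(x² : xy : yz)`, inverse to `(xy : y² : xz)`. -/
noncomputable def tangentialMapInv : PlaneRationalMap where
  degree := 2
  coord := ![X 0 * X 0, X 0 * X 1, X 1 * X 2]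
  isHomogeneous i := by
    fin_cases i <;> exact (isHomogeneous_X _ _).mul (isHomogeneous_X _ _)
  noCommonFactor := by
    refine noCommonFactor_of_prime 0 (mul_ne_zero (X_ne_zero _) (X_ne_zero _))
      fun p hp h0 _ h2 => ?_
    have h := (hp.dvd_or_dvd h0).elim id id
    exact not_X_dvd_of_eval ![0, 1, 1] rfl (by simp) (hp.X_dvd_of_dvd h h2)

/-- The quadratic map `(xy : y² : yz + k x²)`. -/
noncomputable def osculatingMap (k : ℂ) (hk : k ≠ 0) : PlaneRationalMap where
  degree := 2
  coord := ![X 0 * X 1, X 1 * X 1, X 1 * X 2 + C k * (X 0 * X 0)]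
  isHomogeneous i := by
    have h : ∀ i j : Fin 3, (X i * X j : CoordPoly).IsHomogeneous 2 := fun i j =>
      (isHomogeneous_X _ _).mul (isHomogeneous_X _ _)
    fin_cases i
    · exact h _ _
    · exact h _ _
    · exact (h _ _).add ((h _ _).C_mul k)
  noCommonFactor := by
    refine noCommonFactor_of_prime 0 (mul_ne_zero (X_ne_zero _) (X_ne_zero _))
      fun p hp _ h1 h2 => ?_
    have h := (hp.dvd_or_dvd h1).elim id id
    exact not_X_dvd_of_eval ![1, 0, 0] rfl (by simpa using hk) (hp.X_dvd_of_dvd h h2)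

theorem isBirational_standardInvolution : standardInvolution.IsBirational := by
  have h : standardInvolution.IsLeftInverse standardInvolution := by
    refine ⟨X 0 * X 1 * X 2, by simp [X_ne_zero], fun i => ?_⟩
    fin_cases i <;> simp [standardInvolution] <;> ring
  exact ⟨_, h, h⟩

theorem isBirational_tangentialMap : tangentialMap.IsBirational := by
  refine ⟨tangentialMapInv, ⟨X 0 * X 0 * X 1, by simp [X_ne_zero], fun i => ?_⟩,
    ⟨X 0 * X 1 * X 1, by simp [X_ne_zero], fun i => ?_⟩⟩ <;>
  fin_cases i <;> simp [tangentialMap, tangentialMapInv] <;> ring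

theorem isBirational_osculatingMap (k : ℂ) (hk : k ≠ 0) : (osculatingMap k hk).IsBirational := by
  refine ⟨osculatingMap (-k) (neg_ne_zero.mpr hk), ⟨X 1 * X 1 * X 1, by simp [X_ne_zero],
    fun i => ?_⟩, ⟨X 1 * X 1 * X 1, by simp [X_ne_zero], fun i => ?_⟩⟩ <;>
  fin_cases i <;> simp [osculatingMap, MvPolynomial.algebraMap_eq] <;> ring

end PlaneRationalMap

/-! ### Sufficient conditions for a cubic factor -/

namespace QuadraticCoeffs

open PlaneRationalMap

/-- The hypotheses say that the three coordinate points are singular; the involution contracts the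
coordinate lines onto them. -/
theorem hasCubicDrop_of_three_singular {c : QuadraticCoeffs} (ha0 : c.a0 = 0) (hb0 : c.b0 = 0)
    (ha3 : c.a3 = 0) (hq0 : c.q0 = 0) (hq2 : c.q2 = 0) (hb5 : c.b5 = 0) :
    HasCubicDrop c.form := by
  refine ⟨standardInvolution, isBirational_standardInvolution, rfl, X 0 * X 1 * X 2,
    ![(-C c.a2) * X 0 * X 1 ^ 2 * X 2 + (-C c.a5) * X 0 * X 1 * X 2 ^ 2 + (-C c.a1) * X 1 ^ 3 *
      X 2 + (-C c.a4) * X 1 ^ 2 * X 2 ^ 2 + (C c.q1) * X 1 * X 2 ^ 3,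
      (-C c.b2) * X 0 ^ 3 * X 2 + (-C c.b1) * X 0 ^ 2 * X 1 * X 2 + (-C c.b4) * X 0 ^ 2 * X 2 ^
        2 + (-C c.b3) * X 0 * X 1 * X 2 ^ 2 + (-C c.q1) * X 0 * X 2 ^ 3,
      (C c.b2) * X 0 ^ 3 * X 1 + (C c.a2 + C c.b1) * X 0 ^ 2 * X 1 ^ 2 + (C c.a5 + C c.b4) * X 0
        ^ 2 * X 1 * X 2 + (C c.a1) * X 0 * X 1 ^ 3 + (C c.a4 + C c.b3) * X 0 * X 1 ^ 2 * X 2],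
    ((isHomogeneous_X _ _).mul (isHomogeneous_X _ _)).mul (isHomogeneous_X _ _), fun j => ?_⟩
  fin_cases j <;>
  simp [pullbackForm, Fin.sum_univ_three, form, standardInvolution,
    MvPolynomial.algebraMap_eq, ha0, hb0, ha3, hq0, hq2, hb5] <;> ring

/-- Here `(0 : 0 : 1)` and `(0 : 1 : 0)` are singular and `y = 0` is a tangent direction at the
former. The map contracts `x = 0` to `(0 : 1 : 0)`, which yields `x`, and `y = 0` to `(0 : 0 : 1)`,
which yields `y²` because of the infinitely near point. -/
theorem hasCubicDrop_of_two_singular {c : QuadraticCoeffs} (ha0 : c.a0 = 0) (hb0 : c.b0 = 0)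
    (ha1 : c.a1 = 0) (hq2 : c.q2 = 0) (hb5 : c.b5 = 0) :
    HasCubicDrop c.form := by
  refine ⟨tangentialMap, isBirational_tangentialMap, rfl, X 0 * X 1 * X 1,
    ![(-C c.q0) * X 0 * X 1 ^ 3 + (-C c.b3) * X 0 * X 1 ^ 2 * X 2 + (-C c.b1) * X 0 * X 1 * X 2
      ^ 2 + (-C c.q1) * X 1 ^ 4 + (-C c.b4) * X 1 ^ 3 * X 2 + (-C c.b2) * X 1 ^ 2 * X 2 ^ 2,
      (C c.a3) * X 0 ^ 3 * X 2 + (C c.q0) * X 0 ^ 2 * X 1 ^ 2 + (C c.a4 + 2 * C c.b3) * X 0 ^ 2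
        * X 1 * X 2 + (C c.a2 + 2 * C c.b1) * X 0 ^ 2 * X 2 ^ 2 + (C c.q1) * X 0 * X 1 ^ 3 + (C
        c.a5 + 2 * C c.b4) * X 0 * X 1 ^ 2 * X 2 + (2 * C c.b2) * X 0 * X 1 * X 2 ^ 2,
      (-C c.a3) * X 0 ^ 3 * X 1 + (-C c.a4 - C c.b3) * X 0 ^ 2 * X 1 ^ 2 + (-C c.a2 - C c.b1) *
        X 0 ^ 2 * X 1 * X 2 + (-C c.a5 - C c.b4) * X 0 * X 1 ^ 3 + (-C c.b2) * X 0 * X 1 ^ 2 * X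
        2],
    ((isHomogeneous_X _ _).mul (isHomogeneous_X _ _)).mul (isHomogeneous_X _ _), fun j => ?_⟩
  fin_cases j <;>
  simp [pullbackForm, Fin.sum_univ_three, form, tangentialMap,
    MvPolynomial.algebraMap_eq, ha0, hb0, ha1, hq2, hb5] <;> ring

/-- Now `a3 + k (a2 + 2 b1) = 0` for every `k`, so the infinitely near point counts twice: the line
`y = 0` alone yields `y³`, and `(0 : 1 : 0)` need not be singular. -/
theorem hasCubicDrop_of_infinitely_near_double {c : QuadraticCoeffs} (ha0 : c.a0 = 0) (hb0 :
  c.b0 = 0)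
    (ha1 : c.a1 = 0) (ha3 : c.a3 = 0) (h : c.a2 + 2 * c.b1 = 0) :
    HasCubicDrop c.form := by
  have ha2 : c.a2 = -(c.b1 + c.b1) := by
    linear_combination h
  refine ⟨tangentialMap, isBirational_tangentialMap, rfl, X 1 * X 1 * X 1,
    ![(-C c.q0) * X 0 ^ 2 * X 1 ^ 2 + (-C c.b3) * X 0 ^ 2 * X 1 * X 2 + (-C c.b1) * X 0 ^ 2 * X
      2 ^ 2 + (-C c.q1) * X 0 * X 1 ^ 3 + (-C c.b4) * X 0 * X 1 ^ 2 * X 2 + (-C c.b2) * X 0 * X 1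
      * X 2 ^ 2 + (-C c.q2) * X 1 ^ 4 + (-C c.b5) * X 1 ^ 3 * X 2,
      (C c.q0) * X 0 ^ 3 * X 1 + (C c.a4 + 2 * C c.b3) * X 0 ^ 3 * X 2 + (C c.q1) * X 0 ^ 2 * X
        1 ^ 2 + (C c.a5 + 2 * C c.b4) * X 0 ^ 2 * X 1 * X 2 + (2 * C c.b2) * X 0 ^ 2 * X 2 ^ 2 +
        (C c.q2) * X 0 * X 1 ^ 3 + (2 * C c.b5) * X 0 * X 1 ^ 2 * X 2,
      (-C c.a4 - C c.b3) * X 0 ^ 3 * X 1 + (C c.b1) * X 0 ^ 3 * X 2 + (-C c.a5 - C c.b4) * X 0 ^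
        2 * X 1 ^ 2 + (-C c.b2) * X 0 ^ 2 * X 1 * X 2 + (-C c.b5) * X 0 * X 1 ^ 3],
    ((isHomogeneous_X _ _).mul (isHomogeneous_X _ _)).mul (isHomogeneous_X _ _), fun j => ?_⟩
  fin_cases j <;>
  simp [pullbackForm, Fin.sum_univ_three, form, tangentialMap,
    MvPolynomial.algebraMap_eq, ha0, hb0, ha1, ha3, ha2] <;> ring

/-- All three base points lie over `(0 : 0 : 1)`, along the conic `yz = k x²`. The constant `k` is
the one for which `ω` vanishes to higher order on that conic; it is finite and nonzero by the last
two hypotheses. -/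
theorem hasCubicDrop_of_osculating {c : QuadraticCoeffs} (ha0 : c.a0 = 0) (hb0 : c.b0 = 0)
    (ha1 : c.a1 = 0) (ha3 : c.a3 ≠ 0) (h : c.a2 + 2 * c.b1 ≠ 0) :
    HasCubicDrop c.form := by
  obtain ⟨k, hk, e⟩ : ∃ k : ℂ, k ≠ 0 ∧ c.a3 = -(k * (c.a2 + (c.b1 + c.b1))) :=
    ⟨-(c.a3 / (c.a2 + 2 * c.b1)), by simp [ha3, h], by
      field_simp; ring⟩
  refine ⟨(osculatingMap k hk), isBirational_osculatingMap k hk, rfl, X 1 * X 1 * X 1,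
    ![(-C c.a4 * C k - 2 * C c.b2 * C k ^ 2 - 2 * C c.b3 * C k) * X 0 ^ 3 * X 1 + (-C c.a5 * C k
      - 2 * C c.b4 * C k - C c.q0) * X 0 ^ 2 * X 1 ^ 2 + (-C c.a2 * C k - 4 * C c.b1 * C k) * X 0
      ^ 2 * X 1 * X 2 + (-2 * C c.b5 * C k - C c.q1) * X 0 * X 1 ^ 3 + (C c.a4 - 2 * C c.b2 * C k)
      * X 0 * X 1 ^ 2 * X 2 + (-C c.q2) * X 1 ^ 4 + (C c.a5) * X 1 ^ 3 * X 2 + (C c.a2) * X 1 ^ 2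
      * X 2 ^ 2,
      (C c.a4 * C k + 2 * C c.b2 * C k ^ 2 + 2 * C c.b3 * C k) * X 0 ^ 4 + (C c.a5 * C k + 2 * C
        c.b4 * C k + C c.q0) * X 0 ^ 3 * X 1 + (C c.a2 * C k + 3 * C c.b1 * C k) * X 0 ^ 3 * X 2 +
        (2 * C c.b5 * C k + C c.q1) * X 0 ^ 2 * X 1 ^ 2 + (3 * C c.b2 * C k + C c.b3) * X 0 ^ 2 *
        X 1 * X 2 + (C c.q2) * X 0 * X 1 ^ 3 + (C c.b4) * X 0 * X 1 ^ 2 * X 2 + (C c.b1) * X 0 * X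
        1 * X 2 ^ 2 + (C c.b5) * X 1 ^ 3 * X 2 + (C c.b2) * X 1 ^ 2 * X 2 ^ 2,
      (C c.b1 * C k) * X 0 ^ 3 * X 1 + (-C c.a4 - C c.b2 * C k - C c.b3) * X 0 ^ 2 * X 1 ^ 2 +
        (-C c.a5 - C c.b4) * X 0 * X 1 ^ 3 + (-C c.a2 - C c.b1) * X 0 * X 1 ^ 2 * X 2 + (-C c.b5)
        * X 1 ^ 4 + (-C c.b2) * X 1 ^ 3 * X 2],
    ((isHomogeneous_X _ _).mul (isHomogeneous_X _ _)).mul (isHomogeneous_X _ _), fun j => ?_⟩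
  fin_cases j <;>
  simp [pullbackForm, Fin.sum_univ_three, form, osculatingMap,
    MvPolynomial.algebraMap_eq, ha0, hb0, ha1, e] <;> ring

end QuadraticCoeffs

/-! ### Roots of complex polynomials -/

theorem Complex.exists_root_of_coeff_ne_zero {p : Polynomial ℂ} {n : ℕ} (hn : n ≠ 0)
    (h : p.coeff n ≠ 0) : ∃ s, p.eval s = 0 := by
  refine IsAlgClosed.exists_root p fun h0 => ?_
  have h1 := Polynomial.le_natDegree_of_ne_zero h
  rw [Polynomial.natDegree_eq_zero_iff_degree_le_zero.mpr h0.le] at h1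
  omega

theorem Complex.exists_root_of_last_ne_zero {n : ℕ} (hn : n ≠ 0) (f : Fin (n + 1) → ℂ)
    (hf : f (Fin.last n) ≠ 0) : ∃ s : ℂ, ∑ i, f i * s ^ (i : ℕ) = 0 := by
  set p : Polynomial ℂ := ∑ i, Polynomial.C (f i) * Polynomial.X ^ (i : ℕ) with hp
  have hc : p.coeff n ≠ 0 := by
    rw [hp, Polynomial.finsetSum_coeff, Finset.sum_eq_single (Fin.last n)]
    · simpa using hf
    · intro i _ hi
      rw [Polynomial.coeff_C_mul_X_pow, if_neg fun h => hi (Fin.ext h.symm)]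
    · simp
  obtain ⟨s, hs⟩ := exists_root_of_coeff_ne_zero hn hc
  refine ⟨s, ?_⟩
  rw [hp, Polynomial.eval_finsetSum] at hs
  simpa using hs

theorem Complex.exists_root_quadratic {a : ℂ} (ha : a ≠ 0) (b c : ℂ) :
    ∃ s : ℂ, a * s ^ 2 + b * s + c = 0 := by
  obtain ⟨s, hs⟩ := exists_root_of_last_ne_zero two_ne_zero ![c, b, a] ha
  refine ⟨s, ?_⟩
  simp [Fin.sum_univ_three] at hs
  linear_combination hs

/-- The resultant equation for a singular point on the chart `y = 1`, after elimination of `z`. -/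
theorem Complex.exists_root_resultant
    (g l₁ l₀ q₂ q₁ q₀ r₂ r₁ r₀ p₂ p₁ p₀ t₃ t₂ t₁ t₀ d₃ d₂ d₁ d₀ : ℂ)
    (h : -(r₂ * l₁ * p₂ ^ 2) + g * t₃ * q₂ ^ 2 + l₁ * t₃ * d₃ ≠ 0) :
    ∃ s, g ^ 2 * (r₂ * s ^ 2 + r₁ * s + r₀) ^ 2
      + 2 * g * (r₂ * s ^ 2 + r₁ * s + r₀) * (l₁ * s + l₀) * (t₃ * s ^ 3 + t₂ * s ^ 2 + t₁ * s + t₀)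
      + g * (r₂ * s ^ 2 + r₁ * s + r₀) * (p₂ * s ^ 2 + p₁ * s + p₀) * (q₂ * s ^ 2 + q₁ * s + q₀)
      - (r₂ * s ^ 2 + r₁ * s + r₀) * (l₁ * s + l₀) * (p₂ * s ^ 2 + p₁ * s + p₀) ^ 2
      + g * (t₃ * s ^ 3 + t₂ * s ^ 2 + t₁ * s + t₀) * (q₂ * s ^ 2 + q₁ * s + q₀) ^ 2
      + (l₁ * s + l₀) * (t₃ * s ^ 3 + t₂ * s ^ 2 + t₁ * s + t₀)
        * (d₃ * s ^ 3 + d₂ * s ^ 2 + d₁ * s + d₀) = 0 := by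
  -- Only three of the six products reach degree seven, the number of singular points of a foliation
  -- of degree two.
  have hc : (Polynomial.C g ^ 2 * (Polynomial.C r₂ * Polynomial.X ^ 2 + Polynomial.C r₁ *
    Polynomial.X + Polynomial.C r₀) ^ 2
      + Polynomial.C 2 * Polynomial.C g * (Polynomial.C r₂ * Polynomial.X ^ 2 + Polynomial.C r₁
        * Polynomial.X + Polynomial.C r₀) * (Polynomial.C l₁ * Polynomial.X + Polynomial.C l₀)
        * (Polynomial.C t₃ * Polynomial.X ^ 3 + Polynomial.C t₂ * Polynomial.X ^ 2 +
          Polynomial.C t₁ * Polynomial.X + Polynomial.C t₀)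
      + Polynomial.C g * (Polynomial.C r₂ * Polynomial.X ^ 2 + Polynomial.C r₁ * Polynomial.X +
        Polynomial.C r₀) * (Polynomial.C p₂ * Polynomial.X ^ 2 + Polynomial.C p₁ * Polynomial.X +
        Polynomial.C p₀)
        * (Polynomial.C q₂ * Polynomial.X ^ 2 + Polynomial.C q₁ * Polynomial.X + Polynomial.C q₀)
      - (Polynomial.C r₂ * Polynomial.X ^ 2 + Polynomial.C r₁ * Polynomial.X + Polynomial.C r₀)
        * (Polynomial.C l₁ * Polynomial.X + Polynomial.C l₀)
        * (Polynomial.C p₂ * Polynomial.X ^ 2 + Polynomial.C p₁ * Polynomial.X + Polynomial.C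
          p₀) ^ 2
      + Polynomial.C g * (Polynomial.C t₃ * Polynomial.X ^ 3 + Polynomial.C t₂ * Polynomial.X ^
        2 + Polynomial.C t₁ * Polynomial.X + Polynomial.C t₀)
        * (Polynomial.C q₂ * Polynomial.X ^ 2 + Polynomial.C q₁ * Polynomial.X + Polynomial.C
          q₀) ^ 2
      + (Polynomial.C l₁ * Polynomial.X + Polynomial.C l₀) * (Polynomial.C t₃ * Polynomial.X ^ 3
        + Polynomial.C t₂ * Polynomial.X ^ 2 + Polynomial.C t₁ * Polynomial.X + Polynomial.C t₀)
        * (Polynomial.C d₃ * Polynomial.X ^ 3 + Polynomial.C d₂ * Polynomial.X ^ 2 +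
          Polynomial.C d₁ * Polynomial.X + Polynomial.C d₀) : Polynomial ℂ).coeff 7 =
      -(r₂ * l₁ * p₂ ^ 2) + g * t₃ * q₂ ^ 2 + l₁ * t₃ * d₃ := by
    compute_degree!
  obtain ⟨s, hs⟩ := exists_root_of_coeff_ne_zero (by norm_num) (hc ▸ h)
  refine ⟨s, ?_⟩
  simpa using hs

theorem coeffs_eq_zero_of_cubic_eq_zero {p q r s : ℂ}
    (h : ∀ z : ℂ, z ^ 3 * p + z ^ 2 * q + z * r + s = 0) : p = 0 ∧ q = 0 ∧ r = 0 ∧ s = 0 := by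
  have h0 := h 0
  have h1 := h 1
  have h2 := h (-1)
  have h3 := h 2
  refine ⟨?_, ?_, ?_, ?_⟩
  · linear_combination (1 / 2) * h0 - (1 / 2) * h1 - (1 / 6) * h2 + (1 / 6) * h3
  · linear_combination -h0 + (1 / 2) * h1 + (1 / 2) * h2
  · linear_combination -(1 / 2) * h0 + h1 - (1 / 3) * h2 - (1 / 6) * h3
  · linear_combination h0

/-! ### Existence of a singular point -/

/-- The point `v` is a singular point of the form `ω`. -/
def IsSingularAt (ω : Fin 3 → CoordPoly) (v : Fin 3 → ℂ) : Prop :=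
  ∀ i, eval v (ω i) = 0

/-- The form `ω` has two distinct singular points. -/
def HasTwoSingularPoints (ω : Fin 3 → CoordPoly) : Prop :=
  ∃ M : Matrix (Fin 3) (Fin 3) ℂ, M.det ≠ 0 ∧
    IsSingularAt ω (fun i => M i 0) ∧ IsSingularAt ω (fun i => M i 2)

theorem IsSingularAt.of_pullback {ω : Fin 3 → CoordPoly} {M : Matrix (Fin 3) (Fin 3) ℂ}
    (hM : M.det ≠ 0) {v : Fin 3 → ℂ} (h : IsSingularAt (pullbackForm (linearTriple M) ω) v) :
    IsSingularAt ω (M.mulVec v) := by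
  have h0 : Matrix.vecMul (fun i => eval (M.mulVec v) (ω i)) M = 0 := by
    funext j
    have := h j
    rwa [eval_pullbackForm_linearTriple] at this
  exact congrFun (Matrix.eq_zero_of_vecMul_eq_zero hM h0)

theorem HasTwoSingularPoints.of_pullback {ω : Fin 3 → CoordPoly} {M : Matrix (Fin 3) (Fin 3) ℂ}
    (hM : M.det ≠ 0) (h : HasTwoSingularPoints (pullbackForm (linearTriple M) ω)) :
    HasTwoSingularPoints ω := by
  obtain ⟨M', hM', h1, h3⟩ := h
  exact ⟨M * M', by rw [Matrix.det_mul]; exact mul_ne_zero hM hM', h1.of_pullback hM,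
    h3.of_pullback hM⟩

namespace QuadraticCoeffs

theorem isSingularAt_iff {c : QuadraticCoeffs} {x y z : ℂ} : IsSingularAt c.form ![x, y, z] ↔
    eval ![x, y, z] (c.form 0) = 0 ∧ eval ![x, y, z] (c.form 1) = 0 ∧
      eval ![x, y, z] (c.form 2) = 0 := by
  rw [IsSingularAt, Fin.forall_fin_succ, Fin.forall_fin_two]
  rfl

/-- Linear change of coordinates by the matrix with columns `p`, `q`, `r`. -/
theorem exists_linear_change {c : QuadraticCoeffs} (hc : IsQuadraticForm c.form)
    (p q r : Fin 3 → ℂ)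
    (hdet : p 0 * (q 1 * r 2 - r 1 * q 2) - q 0 * (p 1 * r 2 - r 1 * p 2)
      + r 0 * (p 1 * q 2 - q 1 * p 2) ≠ 0) :
    ∃ c' : QuadraticCoeffs, IsQuadraticForm c'.form ∧
      (HasCubicDrop c'.form → HasCubicDrop c.form) ∧
      (HasTwoSingularPoints c'.form → HasTwoSingularPoints c.form) ∧
      ∀ x y z : ℂ, ∀ v : Fin 3 → ℂ, v = ![p 0 * x + q 0 * y + r 0 * z,
          p 1 * x + q 1 * y + r 1 * z, p 2 * x + q 2 * y + r 2 * z] →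
        eval ![x, y, z] (c'.form 0) =
          eval v (c.form 0) * p 0 + eval v (c.form 1) * p 1 + eval v (c.form 2) * p 2 ∧
        eval ![x, y, z] (c'.form 1) =
          eval v (c.form 0) * q 0 + eval v (c.form 1) * q 1 + eval v (c.form 2) * q 2 ∧
        eval ![x, y, z] (c'.form 2) =
          eval v (c.form 0) * r 0 + eval v (c.form 1) * r 1 + eval v (c.form 2) * r 2 := by
  set M : Matrix (Fin 3) (Fin 3) ℂ := !![p 0, q 0, r 0; p 1, q 1, r 1; p 2, q 2, r 2] with hM
  have hMdet : M.det ≠ 0 := by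
    rw [hM, Matrix.det_fin_three]
    convert hdet using 1
    simp
    ring
  have hinv : M * M⁻¹ = 1 := Matrix.mul_nonsing_inv M (isUnit_iff_ne_zero.mpr hMdet)
  have hq := hc.pullback_linearTriple hinv
  obtain ⟨c', hc'⟩ := hq.exists_form
  refine ⟨c', by rwa [← hc'], fun h => ?_, fun h => ?_, fun x y z v hv => ?_⟩
  · exact HasCubicDrop.of_pullback_linearTriple hinv (by rwa [hc'])
  · exact HasTwoSingularPoints.of_pullback hMdet (by rwa [hc'])
  · have hv' : M.mulVec ![x, y, z] = v := by
      rw [hv]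
      funext i
      fin_cases i <;> simp [hM, Matrix.mulVec, dotProduct, Fin.sum_univ_three]
    simp only [← hc', eval_pullbackForm_linearTriple, hv', Fin.sum_univ_three]
    simp [hM]

/-- A quadratic form with nonsingular point `(0 : 0 : 1)` and tangent `y = 0` there has a singular
point. -/
theorem exists_singular_of_b0_ne_zero {c : QuadraticCoeffs} (ha0 : c.a0 = 0) (hb0 : c.b0 ≠ 0) :
    ∃ x y z : ℂ, (x ≠ 0 ∨ y ≠ 0) ∧ IsSingularAt c.form ![x, y, z] := by
  simp only [isSingularAt_iff, eval_form_zero, eval_form_one, eval_form_two]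
  -- Up to sign, this is both the resultant of `B` and `C` on the line `y = 0` and the leading
  -- coefficient of the resultant on `y = 1`. If it vanishes, there is a singular point on `y = 0`.
  by_cases h7 : -c.a1 * c.a3 ^ 2 * c.b1 + c.a1 ^ 2 * c.a3 * c.b3 - c.a1 ^ 3 * c.q0
      + c.a3 ^ 3 * c.b0 = 0
  · by_cases h1 : c.a1 = 0
    · have h3 : c.a3 = 0 := by simpa [h1, hb0] using h7
      obtain ⟨z, hz⟩ := Complex.exists_root_of_last_ne_zero three_ne_zero
        ![c.q0, c.b3, c.b1, c.b0] hb0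
      simp [Fin.sum_univ_four] at hz
      refine ⟨1, 0, z, .inl one_ne_zero, ?_, ?_, ?_⟩
      · rw [ha0, h1, h3]; ring
      · linear_combination hz
      · rw [ha0, h1, h3]; ring
    · refine ⟨1, 0, -c.a3 / c.a1, .inl one_ne_zero, ?_, ?_, ?_⟩
      · rw [ha0]; field_simp; ring
      · field_simp
        linear_combination -h7
      · rw [ha0]; field_simp; ring
  -- The last four coefficients are those of `L T - P Q` in the notation below; its terms in `s⁴`
  -- cancel.
  · obtain ⟨s, hs⟩ := Complex.exists_root_resultant c.b0 c.a1 c.a2 c.a3 c.a4 c.a5 c.q0 c.q1 c.q2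
      c.a1 (c.a2 + c.b1) c.b2 c.a3 (c.a4 + c.b3) (c.a5 + c.b4) c.b5 (c.a1 * c.b3 - c.b1 * c.a3)
      (c.a1 * c.b4 + c.a2 * c.b3 - c.b1 * c.a4 - c.b2 * c.a3)
      (c.a1 * c.b5 + c.a2 * c.b4 - c.b1 * c.a5 - c.b2 * c.a4) (c.a2 * c.b5 - c.b2 * c.a5)
      (fun h => h7 (by linear_combination h))
    set L := c.a1 * s + c.a2 with hL
    set Q := c.a3 * s ^ 2 + c.a4 * s + c.a5 with hQ
    set R := c.q0 * s ^ 2 + c.q1 * s + c.q2 with hR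
    set P := c.a1 * s ^ 2 + (c.a2 + c.b1) * s + c.b2 with hP
    set T := c.a3 * s ^ 3 + (c.a4 + c.b3) * s ^ 2 + (c.a5 + c.b4) * s + c.b5 with hT
    -- At `(s, 1, z)`, the quadratic equation is `C = 0`, and the linear one is `b0 A + L C = 0`,
    -- from which `z²` has disappeared.
    obtain ⟨z, hz1, hz2⟩ : ∃ z, c.b0 * z ^ 2 + P * z + T = 0 ∧
        (c.b0 * Q - L * P) * z = c.b0 * R + L * T := by
      have hres : c.b0 * (c.b0 * R + L * T) ^ 2 + P * (c.b0 * R + L * T) * (c.b0 * Q - L * P)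
          + T * (c.b0 * Q - L * P) ^ 2 = 0 := by
        rw [hL, hQ, hR, hP, hT]
        linear_combination c.b0 * hs
      by_cases hM : c.b0 * Q - L * P = 0
      · obtain ⟨z, hz⟩ := Complex.exists_root_quadratic hb0 P T
        refine ⟨z, hz, ?_⟩
        rw [hM] at hres ⊢
        have : (c.b0 * R + L * T) ^ 2 = 0 :=
          (mul_eq_zero.mp (by linear_combination hres : c.b0 * _ = 0)).resolve_left hb0
        rw [zero_mul, pow_eq_zero_iff two_ne_zero |>.mp this]
      · refine ⟨(c.b0 * R + L * T) / (c.b0 * Q - L * P), ?_, by field_simp⟩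
        have := pow_ne_zero 2 hM
        field_simp
        linear_combination hres
    have hA : z ^ 2 * L + z * Q - R = 0 :=
      (mul_eq_zero.mp (by linear_combination L * hz1 + hz2 :
        c.b0 * (z ^ 2 * L + z * Q - R) = 0)).resolve_left hb0
    rw [hL, hQ, hR] at hA
    rw [hP, hT] at hz1
    refine ⟨s, 1, z, .inr one_ne_zero, ?_, ?_, ?_⟩
    · rw [ha0]; linear_combination hA
    · linear_combination z * hz1 - s * hA
    · rw [ha0]; linear_combination -hz1

end QuadraticCoeffs

namespace QuadraticCoeffs

theorem hasTwoSingularPoints_of_isSingularAt {ω : Fin 3 → CoordPoly}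
    (h : IsSingularAt ω ![0, 0, 1]) {x y z : ℂ} (hxy : x ≠ 0 ∨ y ≠ 0)
    (h' : IsSingularAt ω ![x, y, z]) : HasTwoSingularPoints ω := by
  have h1 : ∀ u v : ℂ, (fun i => (!![x, u, 0; y, v, 0; z, 0, 1] : Matrix _ _ ℂ) i 0) =
      ![x, y, z] := fun u v => by funext i; fin_cases i <;> rfl
  have h3 : ∀ u v : ℂ, (fun i => (!![x, u, 0; y, v, 0; z, 0, 1] : Matrix _ _ ℂ) i 2) =
      ![0, 0, 1] := fun u v => by funext i; fin_cases i <;> rfl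
  rcases hxy with hx | hy
  · exact ⟨!![x, 0, 0; y, 1, 0; z, 0, 1], by simpa [Matrix.det_fin_three] using hx,
      by rwa [h1], by rwa [h3]⟩
  · exact ⟨!![x, 1, 0; y, 0, 0; z, 0, 1], by simpa [Matrix.det_fin_three] using hy,
      by rwa [h1], by rwa [h3]⟩

theorem isSingularAt_origin_iff {c : QuadraticCoeffs} :
    IsSingularAt c.form ![0, 0, 1] ↔ c.a0 = 0 ∧ c.b0 = 0 := by
  simp [isSingularAt_iff, eval_form_zero, eval_form_one, eval_form_two]

theorem exists_singular {c : QuadraticCoeffs} (hc : IsQuadraticForm c.form) :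
    ∃ c' : QuadraticCoeffs, IsQuadraticForm c'.form ∧
      (HasCubicDrop c'.form → HasCubicDrop c.form) ∧ c'.a0 = 0 ∧ c'.b0 = 0 := by
  suffices h : ∀ c : QuadraticCoeffs, IsQuadraticForm c.form → c.a0 = 0 → c.b0 ≠ 0 →
      ∃ c' : QuadraticCoeffs, IsQuadraticForm c'.form ∧
        (HasCubicDrop c'.form → HasCubicDrop c.form) ∧ c'.a0 = 0 ∧ c'.b0 = 0 by
    by_cases hb : c.b0 = 0
    · by_cases ha : c.a0 = 0
      · exact ⟨c, hc, id, ha, hb⟩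
      · obtain ⟨c', hc', hd, -, he⟩ := exists_linear_change hc ![0, 1, 0] ![1, 0, 0] ![0, 0, 1]
          (by simp)
        obtain ⟨e0, e1, -⟩ := he 0 0 1 ![0, 0, 1] (by simp)
        simp [eval_form_zero, eval_form_one, eval_form_two] at e0 e1
        obtain ⟨c'', hc'', hd', h⟩ := h c' hc' (e0.trans hb) (by rwa [e1])
        exact ⟨c'', hc'', hd ∘ hd', h⟩
    -- At `(0 : 0 : 1)` the form is `a0 dx + b0 dy`, which kills `(b0, -a0, 0)`.
    · obtain ⟨c', hc', hd, -, he⟩ := exists_linear_change hc ![c.b0, -c.a0, 0] ![0, 1, 0]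
        ![0, 0, 1] (by simpa using hb)
      obtain ⟨e0, e1, -⟩ := he 0 0 1 ![0, 0, 1] (by simp)
      simp [eval_form_zero, eval_form_one, eval_form_two] at e0 e1
      obtain ⟨c'', hc'', hd', h⟩ := h c' hc' (by rw [e0]; ring) (by rwa [e1])
      exact ⟨c'', hc'', hd ∘ hd', h⟩
  intro c hc ha hb
  obtain ⟨x, y, z, hxy, hs⟩ := exists_singular_of_b0_ne_zero ha hb
  obtain ⟨p, q, hdet⟩ : ∃ p q : Fin 3 → ℂ,
      p 0 * (q 1 * z - y * q 2) - q 0 * (p 1 * z - y * p 2) + x * (p 1 * q 2 - q 1 * p 2) ≠ 0 := by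
    rcases hxy with hx | hy
    · exact ⟨![0, 1, 0], ![0, 0, 1], by simpa using hx⟩
    · exact ⟨![1, 0, 0], ![0, 0, 1], by simpa using hy⟩
  obtain ⟨c', hc', hd, -, he⟩ := exists_linear_change hc p q ![x, y, z] hdet
  obtain ⟨e0, e1, e2⟩ := he 0 0 1 ![x, y, z] (by simp)
  rw [hs, hs, hs] at e0 e1 e2
  exact ⟨c', hc', hd, isSingularAt_origin_iff.mp
    (isSingularAt_iff.mpr ⟨by simpa using e0, by simpa using e1, by simpa using e2⟩)⟩

/-! ### Changing the tangent direction -/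

/-- The restrictions to the lines `y = 0` and `x = 0` determine all the coefficients needed after a
change of coordinates, without expanding the pull-back. -/
theorem coeffs_of_eval_form_two {c : QuadraticCoeffs} {q r : ℂ}
    (h : ∀ z : ℂ, eval ![1, 0, z] (c.form 2) = -(z * q + r)) :
    c.a0 = 0 ∧ c.a1 = q ∧ c.a3 = r := by
  obtain ⟨-, h1, h2, h3⟩ := coeffs_eq_zero_of_cubic_eq_zero (p := 0) (q := c.a0) (r := c.a1 - q)
    (s := c.a3 - r) fun z => by
      have := h z
      rw [eval_form_two] at this
      linear_combination -this
  exact ⟨h1, sub_eq_zero.mp h2, sub_eq_zero.mp h3⟩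

theorem coeffs_of_eval_form_two' {c : QuadraticCoeffs} {q r : ℂ}
    (h : ∀ z : ℂ, eval ![0, 1, z] (c.form 2) = -(z * q + r)) :
    c.b0 = 0 ∧ c.b2 = q ∧ c.b5 = r := by
  obtain ⟨-, h1, h2, h3⟩ := coeffs_eq_zero_of_cubic_eq_zero (p := 0) (q := c.b0) (r := c.b2 - q)
    (s := c.b5 - r) fun z => by
      have := h z
      rw [eval_form_two] at this
      linear_combination -this
  exact ⟨h1, sub_eq_zero.mp h2, sub_eq_zero.mp h3⟩

theorem coeffs_of_eval_form_one {c : QuadraticCoeffs} {p q r s : ℂ}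
    (h : ∀ z : ℂ, eval ![1, 0, z] (c.form 1) = z ^ 3 * p + z ^ 2 * q + z * r + s) :
    c.b0 = p ∧ c.b1 = q ∧ c.b3 = r ∧ c.q0 = s := by
  obtain ⟨h0, h1, h2, h3⟩ := coeffs_eq_zero_of_cubic_eq_zero (p := c.b0 - p) (q := c.b1 - q)
    (r := c.b3 - r) (s := c.q0 - s) fun z => by
      have := h z
      rw [eval_form_one] at this
      linear_combination this
  exact ⟨sub_eq_zero.mp h0, sub_eq_zero.mp h1, sub_eq_zero.mp h2, sub_eq_zero.mp h3⟩

theorem coeffs_of_eval_form_zero {c : QuadraticCoeffs} {p q r s : ℂ}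
    (h : ∀ z : ℂ, eval ![0, 1, z] (c.form 0) = z ^ 3 * p + z ^ 2 * q + z * r - s) :
    c.a0 = p ∧ c.a2 = q ∧ c.a5 = r ∧ c.q2 = s := by
  obtain ⟨h0, h1, h2, h3⟩ := coeffs_eq_zero_of_cubic_eq_zero (p := c.a0 - p) (q := c.a2 - q)
    (r := c.a5 - r) (s := s - c.q2) fun z => by
      have := h z
      rw [eval_form_zero] at this
      linear_combination this
  exact ⟨sub_eq_zero.mp h0, sub_eq_zero.mp h1, sub_eq_zero.mp h2, (sub_eq_zero.mp h3).symm⟩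

/-- Change of coordinates such that the tangent direction `(m : n)` becomes `(1 : 0)` and
`(1 : 0)` becomes `(0 : 1)`. -/
theorem exists_direction_change {c : QuadraticCoeffs} (hc : IsQuadraticForm c.form)
    (ha0 : c.a0 = 0) (hb0 : c.b0 = 0) (m n : ℂ) (hn : n ≠ 0)
    (hm : c.a1 * m ^ 2 + (c.a2 + c.b1) * (m * n) + c.b2 * n ^ 2 = 0) :
    ∃ c' : QuadraticCoeffs, IsQuadraticForm c'.form ∧
      (HasCubicDrop c'.form → HasCubicDrop c.form) ∧
      (HasTwoSingularPoints c'.form → HasTwoSingularPoints c.form) ∧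
      c'.a0 = 0 ∧ c'.b0 = 0 ∧ c'.a1 = 0 ∧
      c'.a3 = c.a3 * m ^ 3 + (c.a4 + c.b3) * (m ^ 2 * n) + (c.a5 + c.b4) * (m * n ^ 2)
        + c.b5 * n ^ 3 ∧
      c'.b2 = c.a1 ∧ c'.b5 = c.a3 ∧
      c'.b1 = c.a1 * m + c.a2 * n ∧ c'.a2 = c.a1 * m + c.b1 * n ∧ c'.q2 = -c.q0 * n := by
  obtain ⟨c', hc', hd, ht, he⟩ := exists_linear_change hc ![m, n, 0] ![1, 0, 0] ![0, 0, 1]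
    (by simpa using hn)
  have e1 : ∀ z : ℂ, _ := fun z => he 1 0 z ![m, n, z] (by simp)
  have e2 : ∀ z : ℂ, _ := fun z => he 0 1 z ![1, 0, z] (by simp)
  simp only [eval_form_zero (c := c), eval_form_one (c := c), eval_form_two (c := c),
    Matrix.cons_val_zero, Matrix.cons_val_one, Matrix.cons_val] at e1 e2
  obtain ⟨h1, h2, h3⟩ := coeffs_of_eval_form_two (c := c') (q := 0)
    (r := c.a3 * m ^ 3 + (c.a4 + c.b3) * (m ^ 2 * n) + (c.a5 + c.b4) * (m * n ^ 2)
      + c.b5 * n ^ 3) fun z => by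
    rw [(e1 z).2.2, ha0, hb0]
    linear_combination -z * hm
  obtain ⟨h4, h5, h6⟩ := coeffs_of_eval_form_two' (c := c') (q := c.a1) (r := c.a3) fun z => by
    rw [(e2 z).2.2, ha0, hb0]
    ring
  obtain ⟨h7, h8, h9, h10⟩ := coeffs_of_eval_form_one (c := c') (p := 0)
    (q := c.a1 * m + c.a2 * n) (r := c.a3 * m ^ 2 + c.a4 * (m * n) + c.a5 * n ^ 2)
    (s := -n * (c.q0 * m ^ 2 + c.q1 * (m * n) + c.q2 * n ^ 2)) fun z => by
    rw [(e1 z).2.1, ha0, hb0]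
    ring
  obtain ⟨h11, h12, h13, h14⟩ := coeffs_of_eval_form_zero (c := c') (p := 0)
    (q := c.a1 * m + c.b1 * n) (r := c.a3 * m + c.b3 * n) (s := -c.q0 * n) fun z => by
    rw [(e2 z).1, ha0, hb0]
    ring
  exact ⟨c', hc', hd, ht, h1, h4, h2, h3, h5, h6, h8, h12, h14⟩

/-! ### A cubic factor or a second singular point -/

/-- If `a3 = 0`, the line `y = 0` is invariant and its other singular points are the zeros of `b1 z²
+ b3 z + q0`. Otherwise the osculating map applies. -/
theorem hasCubicDrop_or_hasTwoSingularPoints_of_b1_ne_zero {c : QuadraticCoeffs}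
    (ha0 : c.a0 = 0) (hb0 : c.b0 = 0)
    (ha1 : c.a1 = 0) (hb1 : c.b1 ≠ 0) (h : c.a2 + 2 * c.b1 ≠ 0) :
    HasCubicDrop c.form ∨ HasTwoSingularPoints c.form := by
  by_cases ha3 : c.a3 = 0
  · obtain ⟨z, hz⟩ := Complex.exists_root_quadratic hb1 c.b3 c.q0
    refine .inr (hasTwoSingularPoints_of_isSingularAt (isSingularAt_origin_iff.mpr ⟨ha0, hb0⟩)
      (x := 1) (y := 0) (z := z) (.inl one_ne_zero) (isSingularAt_iff.mpr ⟨?_, ?_, ?_⟩))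
    · rw [eval_form_zero, ha0, ha1, ha3]; ring
    · rw [eval_form_one, hb0]; linear_combination hz
    · rw [eval_form_two, ha0, ha1, ha3]; ring
  · exact .inl (hasCubicDrop_of_osculating ha0 hb0 ha1 ha3 h)

/-- The linear part is `b2 y dy`. On `y = 1`, `C = 0` gives `z` in terms of `x`, and `A = 0` becomes
a quintic in `x` with leading coefficient `a3²`. -/
theorem hasTwoSingularPoints_of_cusp {c : QuadraticCoeffs} (ha0 : c.a0 = 0) (hb0 : c.b0 = 0)
    (ha1 : c.a1 = 0) (ha2 : c.a2 = 0) (hb1 : c.b1 = 0) (hb2 : c.b2 ≠ 0) (ha3 : c.a3 ≠ 0) :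
    HasTwoSingularPoints c.form := by
  obtain ⟨s, hs⟩ := Complex.exists_root_of_last_ne_zero (n := 5) (by norm_num)
    ![c.b5 * c.a5 + c.b2 * c.q2,
      (c.a5 + c.b4) * c.a5 + c.b5 * c.a4 + c.b2 * c.q1,
      (c.a4 + c.b3) * c.a5 + (c.a5 + c.b4) * c.a4 + c.b5 * c.a3 + c.b2 * c.q0,
      c.a3 * c.a5 + (c.a4 + c.b3) * c.a4 + (c.a5 + c.b4) * c.a3,
      c.a3 * c.a4 + (c.a4 + c.b3) * c.a3, c.a3 * c.a3] (mul_ne_zero ha3 ha3)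
  simp [Fin.sum_univ_six] at hs
  obtain ⟨z, hz⟩ : ∃ z, c.b2 * z = -(c.a3 * s ^ 3 + (c.a4 + c.b3) * s ^ 2 + (c.a5 + c.b4) * s
      + c.b5) :=
    ⟨-(c.a3 * s ^ 3 + (c.a4 + c.b3) * s ^ 2 + (c.a5 + c.b4) * s + c.b5) / c.b2, by field_simp⟩
  have hA : z * (c.a3 * s ^ 2 + c.a4 * s + c.a5) - (c.q0 * s ^ 2 + c.q1 * s + c.q2) = 0 := by
    refine (mul_eq_zero.mp (?_ : c.b2 * _ = 0)).resolve_left hb2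
    linear_combination (c.a3 * s ^ 2 + c.a4 * s + c.a5) * hz - hs
  refine hasTwoSingularPoints_of_isSingularAt (isSingularAt_origin_iff.mpr ⟨ha0, hb0⟩)
    (x := s) (y := 1) (z := z) (.inr one_ne_zero) (isSingularAt_iff.mpr ⟨?_, ?_, ?_⟩)
  · rw [eval_form_zero, ha0, ha1, ha2]; linear_combination hA
  · rw [eval_form_one, hb0, hb1]; linear_combination z * hz - s * hA
  · rw [eval_form_two, ha0, hb0, ha1, ha2, hb1]; linear_combination -hz

theorem hasCubicDrop_or_hasTwoSingularPoints_of_direction {c : QuadraticCoeffs}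
    (hc : IsQuadraticForm c.form)
    (ha0 : c.a0 = 0) (hb0 : c.b0 = 0) (ha1 : c.a1 = 0) :
    HasCubicDrop c.form ∨ HasTwoSingularPoints c.form := by
  -- The other tangent direction is `(-b2 : a2 + b1)`; moving it to `y = 0` exchanges `a2` and `b1`
  -- up to the factor `a2 + b1`.
  have swap : c.a2 + c.b1 ≠ 0 → c.a2 ≠ 0 → c.b1 + 2 * c.a2 ≠ 0 →
      HasCubicDrop c.form ∨ HasTwoSingularPoints c.form := by
    intro hs h1 h2
    obtain ⟨c', -, hd, ht, h⟩ := exists_direction_change hc ha0 hb0 (-c.b2) (c.a2 + c.b1) hs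
      (by rw [ha1]; ring)
    obtain ⟨ha0', hb0', ha1', -, -, -, hb1', ha2', -⟩ := h
    refine
      (hasCubicDrop_or_hasTwoSingularPoints_of_b1_ne_zero ha0' hb0' ha1' ?_ ?_).imp hd ht
    · rw [hb1', ha1]
      simpa using ⟨h1, hs⟩
    · rw [hb1', ha2', ha1]
      convert mul_ne_zero hs h2 using 1
      ring
  by_cases ha3 : c.a3 = 0 <;> by_cases h : c.a2 + 2 * c.b1 = 0
  · exact .inl (hasCubicDrop_of_infinitely_near_double ha0 hb0 ha1 ha3 h)
  · by_cases hb1 : c.b1 = 0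
    · have ha2 : c.a2 ≠ 0 := by simpa [hb1] using h
      exact swap (by simpa [hb1] using ha2) ha2 (by simpa [hb1] using ha2)
    · exact hasCubicDrop_or_hasTwoSingularPoints_of_b1_ne_zero ha0 hb0 ha1 hb1 h
  · have ha2 : c.a2 = -2 * c.b1 := by linear_combination h
    by_cases hb1 : c.b1 = 0
    · have ha2 : c.a2 = 0 := by rw [ha2, hb1, mul_zero]
      by_cases hb2 : c.b2 = 0
      -- The linear part vanishes, so every direction is admissible; the root `m` is chosen to make
      -- the new `a3` vanish.
      · obtain ⟨m, hm⟩ := Complex.exists_root_of_last_ne_zero (n := 3) (by norm_num)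
          ![c.b5, c.a5 + c.b4, c.a4 + c.b3, c.a3] ha3
        simp [Fin.sum_univ_four] at hm
        obtain ⟨c', -, hd, -, h⟩ := exists_direction_change hc ha0 hb0 m 1 one_ne_zero
          (by rw [ha1, ha2, hb1, hb2]; ring)
        obtain ⟨ha0', hb0', ha1', ha3', -, -, hb1', ha2', -⟩ := h
        refine .inl (hd (hasCubicDrop_of_infinitely_near_double ha0' hb0' ha1' ?_ ?_))
        · rw [ha3']; linear_combination hm
        · rw [ha2', hb1', ha1, ha2, hb1]; ring
      · exact .inr (hasTwoSingularPoints_of_cusp ha0 hb0 ha1 ha2 hb1 hb2 ha3)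
    · refine swap ?_ ?_ ?_
      · rw [ha2]; convert neg_ne_zero.mpr hb1 using 1; ring
      · rw [ha2]; simpa using hb1
      · rw [ha2]; convert mul_ne_zero (by norm_num : (-3 : ℂ) ≠ 0) hb1 using 1; ring
  · exact .inl (hasCubicDrop_of_osculating ha0 hb0 ha1 ha3 h)

theorem hasCubicDrop_or_hasTwoSingularPoints {c : QuadraticCoeffs} (hc : IsQuadraticForm c.form)
    (ha0 : c.a0 = 0) (hb0 : c.b0 = 0) :
    HasCubicDrop c.form ∨ HasTwoSingularPoints c.form := by
  by_cases ha1 : c.a1 = 0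
  · exact
      hasCubicDrop_or_hasTwoSingularPoints_of_direction hc ha0 hb0 ha1
  · obtain ⟨m, hm⟩ := Complex.exists_root_quadratic ha1 (c.a2 + c.b1) c.b2
    obtain ⟨c', hc', hd, ht, h⟩ := exists_direction_change hc ha0 hb0 m 1 one_ne_zero
      (by linear_combination hm)
    exact
      (hasCubicDrop_or_hasTwoSingularPoints_of_direction hc' h.1 h.2.1 h.2.2.1).imp hd ht

/-! ### From two singular points to a cubic factor -/

/-- Two singular points `(1 : 0 : 0)` and `(0 : 0 : 1)` suffice, unless `(0 : 0 : 1)` is a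
nondegenerate point whose only tangent direction is that of the line joining them. -/
theorem hasCubicDrop_or_of_two_singular {c : QuadraticCoeffs} (hc : IsQuadraticForm c.form)
    (ha0 : c.a0 = 0) (hb0 : c.b0 = 0) (ha3 : c.a3 = 0) (hq0 : c.q0 = 0) :
    HasCubicDrop c.form ∨ c.a1 = 0 ∧ c.a2 + c.b1 = 0 ∧ c.b2 ≠ 0 ∧ c.b1 ≠ 0 := by
  -- A tangent direction `(m : 1)` is not that of the joining line `y = 0`. Moved to `(1 : 0)`, it
  -- sends the other singular point to `(0 : 1 : 0)`.
  have key : (∃ m, c.a1 * m ^ 2 + (c.a2 + c.b1) * m + c.b2 = 0) → HasCubicDrop c.form := by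
    rintro ⟨m, hm⟩
    obtain ⟨c', -, hd, -, ha0', hb0', ha1', -, -, hb5', -, -, hq2'⟩ :=
      exists_direction_change hc ha0 hb0 m 1 one_ne_zero (by linear_combination hm)
    exact hd (hasCubicDrop_of_two_singular ha0' hb0' ha1' (by rw [hq2', hq0]; ring)
      (hb5'.trans ha3))
  by_cases ha1 : c.a1 = 0
  · by_cases hs : c.a2 + c.b1 = 0
    · by_cases hb2 : c.b2 = 0
      · exact .inl (key ⟨0, by rw [ha1, hs, hb2]; ring⟩)
      · by_cases hb1 : c.b1 = 0
        · exact .inl (hasCubicDrop_of_infinitely_near_double ha0 hb0 ha1 ha3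
            (by linear_combination hs + hb1))
        · exact .inr ⟨ha1, hs, hb2, hb1⟩
    · exact .inl (key ⟨-c.b2 / (c.a2 + c.b1), by rw [ha1]; field_simp; ring⟩)
  · exact .inl (key (Complex.exists_root_quadratic ha1 _ _))

theorem hasCubicDrop_of_two_singular_points {c : QuadraticCoeffs} (hc : IsQuadraticForm c.form)
    (ha0 : c.a0 = 0) (hb0 : c.b0 = 0) (ha3 : c.a3 = 0) (hq0 : c.q0 = 0) :
    HasCubicDrop c.form := by
  rcases hasCubicDrop_or_of_two_singular hc ha0 hb0 ha3 hq0 with h | ⟨ha1, hs, hb2, hb1⟩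
  · exact h
  -- Exchanging `x` and `z` applies the same dichotomy at `(1 : 0 : 0)`.
  obtain ⟨c', hc', hd, -, he⟩ := exists_linear_change hc ![0, 0, 1] ![0, 1, 0] ![1, 0, 0]
    (by simp)
  have e1 : ∀ z : ℂ, _ := fun z => he 1 0 z ![z, 0, 1] (by simp)
  have e2 : ∀ z : ℂ, _ := fun z => he 0 1 z ![z, 1, 0] (by simp)
  simp only [eval_form_zero (c := c), eval_form_one (c := c), eval_form_two (c := c),
    Matrix.cons_val_zero, Matrix.cons_val_one, Matrix.cons_val] at e1 e2
  obtain ⟨h1, h2, h3⟩ := coeffs_of_eval_form_two (c := c') (q := 0) (r := 0) fun z => by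
    rw [(e1 z).2.2, ha0, ha1, ha3]
    ring
  obtain ⟨h4, h5, h6⟩ := coeffs_of_eval_form_two' (c := c') (q := c.q1) (r := c.q2) fun z => by
    rw [(e2 z).2.2, hq0]
    ring
  obtain ⟨h7, h8, h9, h10⟩ := coeffs_of_eval_form_one (c := c') (p := 0) (q := c.b3) (r := c.b1)
    (s := 0) fun z => by
    rw [(e1 z).2.1, hb0, hq0]
    ring
  obtain ⟨h11, h12, h13, h14⟩ := coeffs_of_eval_form_zero (c := c') (p := 0)
    (q := -(c.a4 + c.b3)) (r := -(c.a5 + c.b4)) (s := c.b5) fun z => by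
    rw [(e2 z).1, ha3]
    ring
  rcases hasCubicDrop_or_of_two_singular hc' h1 h4 h3 h10 with h | ⟨-, hs', hb2', hb1'⟩
  · exact hd h
  rw [h12, h8] at hs'
  rw [h5] at hb2'
  rw [h8] at hb1'
  have ha4 : c.a4 = 0 := by linear_combination -hs'
  have ha2 : c.a2 = -c.b1 := by linear_combination hs
  have ha2' : c.a2 ≠ 0 := by rw [ha2]; exact neg_ne_zero.mpr hb1
  -- On `y = 1`, `A = 0` reads `q1 x = a2 z² + a5 z - q2`. Inserted into `C = 0` times `q1²`, this
  -- gives a quartic in `z` with leading coefficient `b3 a2²`.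
  obtain ⟨z, hz⟩ := Complex.exists_root_of_last_ne_zero (n := 4) (by norm_num)
    ![c.b3 * c.q2 ^ 2 - (c.a5 + c.b4) * c.q2 * c.q1 + c.b5 * c.q1 ^ 2,
      -2 * c.b3 * c.a5 * c.q2 + (c.a5 + c.b4) * c.a5 * c.q1 + c.b2 * c.q1 ^ 2,
      c.b3 * (c.a5 ^ 2 - 2 * c.a2 * c.q2) + (c.a5 + c.b4) * c.a2 * c.q1,
      2 * c.b3 * c.a2 * c.a5, c.b3 * c.a2 ^ 2] (mul_ne_zero hb1' (pow_ne_zero 2 ha2'))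
  simp [Fin.sum_univ_five] at hz
  obtain ⟨x, hx⟩ : ∃ x, c.q1 * x = c.a2 * z ^ 2 + c.a5 * z - c.q2 :=
    ⟨(c.a2 * z ^ 2 + c.a5 * z - c.q2) / c.q1, by field_simp⟩
  have hC : c.b2 * z + c.b3 * x ^ 2 + (c.a5 + c.b4) * x + c.b5 = 0 := by
    refine (mul_eq_zero.mp (?_ : c.q1 ^ 2 * _ = 0)).resolve_left (pow_ne_zero 2 hb2')
    linear_combination hz + (c.b3 * (c.q1 * x + (c.a2 * z ^ 2 + c.a5 * z - c.q2))
      + (c.a5 + c.b4) * c.q1) * hx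
  -- The new point `(x : 1 : z)` is off the line `y = 0`, so the three singular points can be made
  -- the coordinate points.
  obtain ⟨c'', -, hd', -, he'⟩ := exists_linear_change hc ![1, 0, 0] ![x, 1, z] ![0, 0, 1]
    (by simp)
  obtain ⟨p0, p1, p2⟩ := he' 1 0 0 ![1, 0, 0] (by simp)
  obtain ⟨r0, r1, r2⟩ := he' 0 1 0 ![x, 1, z] (by simp)
  obtain ⟨t0, t1, t2⟩ := he' 0 0 1 ![0, 0, 1] (by simp)
  have s0 : eval ![x, 1, z] (c.form 0) = 0 := by
    rw [eval_form_zero, ha0, ha1, ha3, ha4, hq0]; linear_combination -hx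
  have s2 : eval ![x, 1, z] (c.form 2) = 0 := by
    rw [eval_form_two, ha0, hb0, ha1, ha3, ha4, hs]; linear_combination -hC
  have s1 : eval ![x, 1, z] (c.form 1) = 0 := by
    rw [eval_form_zero] at s0
    rw [eval_form_two] at s2
    rw [eval_form_one]
    linear_combination -x * s0 - z * s2
  rw [s0, s1, s2] at r0 r2
  simp [eval_form_zero, eval_form_one, eval_form_two, ha0, hb0, ha3, hq0] at p0 p1 p2 r0 r2 t0 t1
  exact hd' (hasCubicDrop_of_three_singular t0 t1 p2 (by simpa [s0, s1, s2] using p1) r0 r2)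

theorem hasCubicDrop {c : QuadraticCoeffs} (hc : IsQuadraticForm c.form) :
    HasCubicDrop c.form := by
  obtain ⟨c₁, hc₁, hd₁, ha0, hb0⟩ := exists_singular hc
  refine hd₁ <| (hasCubicDrop_or_hasTwoSingularPoints hc₁ ha0 hb0).elim id
    fun ⟨M, hM, hs1, hs3⟩ => ?_
  obtain ⟨c₂, hc₂, hd₂, -, he⟩ := exists_linear_change hc₁ (fun i => M i 0) (fun i => M i 1)
    (fun i => M i 2) (fun h => hM (by rw [Matrix.det_fin_three]; linear_combination h))
  obtain ⟨p0, p1, p2⟩ := he 1 0 0 (fun i => M i 0) (by funext i; fin_cases i <;> simp)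
  obtain ⟨t0, t1, t2⟩ := he 0 0 1 (fun i => M i 2) (by funext i; fin_cases i <;> simp)
  rw [hs1, hs1, hs1] at p1 p2
  rw [hs3, hs3, hs3] at t0 t1
  simp [eval_form_zero, eval_form_one, eval_form_two] at p1 p2 t0 t1
  exact hd₂ (hasCubicDrop_of_two_singular_points hc₂ t0 t1 p2 p1)

end QuadraticCoeffs

theorem theoremA (F : PlaneFoliation) (hF : F.degree = 2) :
    ∃ ψ : PlaneRationalMap, ψ.IsBirational ∧ ψ.degree = 2 ∧
      ∃ G : PlaneFoliation, G.IsPullback ψ F ∧ G.degree ≤ 3 := by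
  have hω : IsQuadraticForm F.coeff := ⟨fun i => by
    have h := F.isHomogeneous i
    rwa [hF] at h, F.euler, F.noCommonFactor⟩
  obtain ⟨c, hc⟩ := hω.exists_form
  exact HasCubicDrop.exists_foliation hω (hc ▸ QuadraticCoeffs.hasCubicDrop (hc ▸ hω))
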